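/- **Setting.** Let $A_1,\dots,A_L\in\mathbb C\setminus\{0\}$ and $\sigma>0$. For each sample size $N$ let $f_l=f_{l,N}\in[-\tfrac12,\tfrac12]$ be frequencies, and observe $$x(n)=\sum_{l=1}^L A_l e^{j2\pi f_l n}+w(n),\qquad n=0,\dots,N-1,$$ where the $w(n)$ are i.i.d. circular complex Gaussian with mean $0$ and $E|w(n)|^2=\sigma^2$. Put $\rho_l=|A_l|^2/\sigma^2$. Write $f_l=(m_l+\delta_l)/N$, where $m_l=m_{l,N}\in\mathbb Z$ is the true maximum bin and $\delta_l\in[-\tfrac12,\tfrac12]$ is the residual. **Assumption 1.** The frequency separation is of order one: there is $\Delta>0$ independent of $N$ with $|f_p-f_l-k|\ge\Delta$ for all $p\ne l$, all $k\in\mathbb Z$ and all $N$. **Algorithm.** Let $X(k)=\frac1N\sum_{n=0}^{N-1}x(n)e^{-j2\pi kn/N}$ and $D(t)=\frac1N\sum_{n=0}^{N-1}e^{j2\pi tn/N}$. Let $\hat m_l$ be coarse (possibly random) integer bin estimates that equal the true maximum bins $m_l$ for all $l$ with probability tending to $1$. From residual estimates $\nu_l$ and amplitude estimates $\hat A_l$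 of the previous iteration, one iteration computes, for every $p$, $$\hat S_{\pm}=X(\hat m_p+\nu_p\pm\tfrac12)-\sum_{l\ne p}\hat A_l\,D(\hat m_l+\nu_l-\hat m_p-\nu_p\mp\tfrac12),\qquad \hat h=\tfrac12\,\frac{\hat S_++\hat S_-}{\hat S_+-\hat S_-},$$ $$\hat\delta_p=\nu_p-\frac N{2\pi}\,\Im\ln\!\Big(\cos\frac\pi N-2j\hat h\sin\frac\pi N\Big),\qquad \hat f_p=\frac{\hat m_p+\hat\delta_p}N,$$ and then replaces every $\hat A_p$ by $X(\hat m_p+\hat\delta_p)-\sum_{l\neq p}\hat A_l\,D(\hat m_l+\hat\delta_l-\hat m_p-\hat\delta_p)$. The starting residuals are arbitrary deterministic numbers in $[-\tfrac12,\tfrac12]$ (possibly depending on $N$), and the starting amplitudes are arbitrary and bounded in probability (for instance, all starting values are $0$). **Mean and variance.** For $l\ne p$ let $$\beta_{\pm,l}=\frac{1+e^{j2\pi(\delta_l-\nu_p)}}{1-e^{j\frac{2\pi}N(m_l-m_p+\delta_l-\nu_p\mp\frac12)}}-D(\delta_l-\nu_l)\,\frac{1+e^{j2\pi(\nu_l-\nu_p)}}{1-e^{j\frac{2\pi}N(m_l-m_p+\nu_l-\nu_p\mp\frac12)}},$$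 let $t_p=\delta_p-\nu_p$, and let $$\mu_{f_p}=\frac{\pi(t_p^2-\frac14)}{2N^2\cos(\pi t_p)}\Big\{(1-2t_p)\,\Im\Big[e^{-j\pi t_p}\sum_{l\ne p}\tfrac{A_l}{A_p}\beta_{+,l}\Big]+(1+2t_p)\,\Im\Big[e^{-j\pi t_p}\sum_{l\ne p}\tfrac{A_l}{A_p}\beta_{-,l}\Big]\Big\},$$ $$\sigma_{f_p}^2=\frac{\pi^2(t_p^2-\frac14)^2}{4\rho_pN^3\cos^2(\pi t_p)}\,(1+4t_p^2),$$ where $(t^2-\frac14)/\cos(\pi t)$ is read as its limit $-1/\pi$ at $t=\pm\frac12$. **Theorem 1.** Under Assumption 1: (a) At every iteration, with $\nu$ the residual estimates of the previous iteration, the frequency estimates are asymptotically independent and normal, $\hat f_p\to\mathcal N(f_p+\mu_{f_p},\sigma^2_{f_p})$. That is, as $N\to\infty$, the random vector $$\Big(\frac{\hat f_p-(f_p+\mu_{f_p})}{\sigma_{f_p}}\Big)_{p=1}^{L}$$ converges in distribution to a vector of $L$ independent $\mathcal N(0,1)$ variables. (b) $\mu_{f_p}$ is the error due to leakage: if $w=0$,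 $\hat m_l=m_l$, the residuals $\nu_l\in[-\tfrac12,\tfrac12]$ are deterministic, and the amplitude estimates are $\hat A_p=X(m_p+\nu_p)-\sum_{l\neq p}b_l\,D(m_l+\nu_l-m_p-\nu_p)$ with bounded deterministic $b_l$ (possibly depending on $N$), then the iteration started from $(\nu,\hat A)$ gives $\hat f_p=f_p+\mu_{f_p}+O(N^{-3})$ for every $p$. -/

import Mathlib

open MeasureTheory ProbabilityTheory Filter Topology Asymptotics

noncomputable section

namespace FreqEst

/-! ### Signal model -/

/-- The noise-free superposition `∑ₗ Aₗ exp(j 2π fₗ n)`. -/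
def tones {L : ℕ} (A : Fin L → ℂ) (f : Fin L → ℝ) (n : ℕ) : ℂ :=
  ∑ l, A l * Complex.exp (2 * Real.pi * Complex.I * ((f l : ℂ) * n))

/-- Circular complex Gaussian law with mean `0` and variance `E|w|² = σ²`: real and imaginary
parts are independent real Gaussians with mean `0` and variance `σ² / 2`. -/
def circularGaussian (σ : ℝ) : Measure ℂ :=
  ((gaussianReal 0 (Real.toNNReal (σ ^ 2 / 2))).prod
    (gaussianReal 0 (Real.toNNReal (σ ^ 2 / 2)))).map
    (fun q : ℝ × ℝ => (q.1 : ℂ) + (q.2 : ℂ) * Complex.I)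

/-- The frequencies (which may vary with the sample size `N`) are separated by an amount of order
one, i.e. by a positive constant that does not depend on `N`. Frequencies are normalised, so that
`f` and `f + k` with `k` an integer describe the same exponential; the separation is therefore
measured modulo `1`. -/
def SeparatedFrequencies {L : ℕ} (f : ℕ → Fin L → ℝ) : Prop :=
  ∃ Δ : ℝ, 0 < Δ ∧ ∀ N : ℕ, ∀ p l : Fin L, p ≠ l → ∀ k : ℤ, Δ ≤ |f N p - f N l - k|

/-! ### The estimation algorithm -/

/-- Normalised Fourier coefficient of `x(0), …, x(N-1)` at the (fractional) location `k`. -/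
def fourierCoeff (N : ℕ) (x : ℕ → ℂ) (k : ℝ) : ℂ :=
  (1 / N) * ∑ n ∈ Finset.range N, x n * Complex.exp (-(2 * Real.pi * Complex.I / N) * (k * n))

/-- Normalised Fourier coefficient of a unit exponential, at distance `t` (in bins) from its
frequency; equal to `(1 - exp(j 2π t)) / (N (1 - exp(j 2π t / N)))` where that is defined. -/
def dirichlet (N : ℕ) (t : ℝ) : ℂ :=
  (1 / N) * ∑ n ∈ Finset.range N, Complex.exp ((2 * Real.pi * Complex.I / N) * (t * n))

/-- Estimates of the residuals `δₗ` and of the complex amplitudes `Aₗ`. -/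
structure Estimates (L : ℕ) where
  /-- the residual estimates -/
  residual : Fin L → ℝ
  /-- the amplitude estimates -/
  amplitude : Fin L → ℂ

variable {L : ℕ}

/-- The estimated total leakage of the components `l ≠ p` at the location
`m_p + ν_p + s / 2`, for `s = ±1`. -/
def leakage (N : ℕ) (m : Fin L → ℤ) (e : Estimates L) (p : Fin L) (s : ℝ) : ℂ :=
  ∑ l ∈ Finset.univ.erase p, e.amplitude l *
    dirichlet N (((m l - m p : ℤ) : ℝ) + e.residual l - e.residual p - s / 2)

/-- The leakage-free Fourier coefficient of component `p` at `m_p + ν_p + s / 2`, `s = ±1`. -/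
def cleanCoeff (N : ℕ) (m : Fin L → ℤ) (x : ℕ → ℂ) (e : Estimates L) (p : Fin L) (s : ℝ) : ℂ :=
  fourierCoeff N x ((m p : ℝ) + e.residual p + s / 2) - leakage N m e p s

/-- The estimate of `exp(-j 2π δ / N)` from the coefficients at distance `±1/2` from the current
location, `δ` being the remaining residual. -/
def zInv (N : ℕ) (Splus Sminus : ℂ) : ℂ :=
  let h : ℂ := (1 / 2) * ((Splus + Sminus) / (Splus - Sminus))
  (Real.cos (Real.pi / N) : ℂ) - 2 * Complex.I * h * (Real.sin (Real.pi / N) : ℂ)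

/-- The interpolation estimator: the correction to be added to the current residual. -/
def interpolate (N : ℕ) (Splus Sminus : ℂ) : ℝ :=
  -(N / (2 * Real.pi)) * (Complex.log (zInv N Splus Sminus)).im

/-- The new residual estimates from the previous estimates of all components. -/
def newResidual (N : ℕ) (m : Fin L → ℤ) (x : ℕ → ℂ) (e : Estimates L) (p : Fin L) : ℝ :=
  e.residual p + interpolate N (cleanCoeff N m x e p 1) (cleanCoeff N m x e p (-1))

/-- Amplitude estimates at the residuals `ν`: the Fourier coefficient at the estimated frequency
minus the leakage of the other components, with their current amplitude estimates `a`. -/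
def newAmplitude (N : ℕ) (m : Fin L → ℤ) (x : ℕ → ℂ) (ν : Fin L → ℝ) (a : Fin L → ℂ)
    (p : Fin L) : ℂ :=
  fourierCoeff N x ((m p : ℝ) + ν p) -
    ∑ l ∈ Finset.univ.erase p, a l * dirichlet N (((m l - m p : ℤ) : ℝ) + ν l - ν p)

/-- One iteration of the algorithm. -/
def step (N : ℕ) (m : Fin L → ℤ) (x : ℕ → ℂ) (e : Estimates L) : Estimates L where
  residual := newResidual N m x e
  amplitude := newAmplitude N m x (newResidual N m x e) e.amplitude

/-- The estimates after `i` iterations, from the starting values `e₀`. -/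
def iterate (N : ℕ) (m : Fin L → ℤ) (x : ℕ → ℂ) (e₀ : Estimates L) (i : ℕ) : Estimates L :=
  (step N m x)^[i] e₀

/-- Frequency estimates `(m_p + δ̂_p) / N`. -/
def freq (N : ℕ) (m : Fin L → ℤ) (δ : Fin L → ℝ) (p : Fin L) : ℝ := ((m p : ℝ) + δ p) / N

/-! ### The asymptotic mean and variance -/

/-- `(t² - 1/4) / cos (π t)`, with the removable singularities at `t = ±1/2` filled in by the
limit `-1/π`. -/
def gain (t : ℝ) : ℝ :=
  if |t| = 1 / 2 then -(1 / Real.pi) else (t ^ 2 - 1 / 4) / Real.cos (Real.pi * t)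

/-- The leakage factor `β_{s,l}` of component `l` on component `p`, `s = ±1`, with true bins `m`,
true residuals `δ` and previous residual estimates `ν`. -/
def beta (N : ℕ) (m : Fin L → ℤ) (δ ν : Fin L → ℝ) (p l : Fin L) (s : ℝ) : ℂ :=
  (1 + Complex.exp (2 * Real.pi * Complex.I * ((δ l - ν p : ℝ) : ℂ))) /
      (1 - Complex.exp ((2 * Real.pi * Complex.I / N) *
        ((((m l - m p : ℤ) : ℝ) + δ l - ν p - s / 2 : ℝ) : ℂ))) -
    dirichlet N (δ l - ν l) *
      ((1 + Complex.exp (2 * Real.pi * Complex.I * ((ν l - ν p : ℝ) : ℂ))) /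
        (1 - Complex.exp ((2 * Real.pi * Complex.I / N) *
          ((((m l - m p : ℤ) : ℝ) + ν l - ν p - s / 2 : ℝ) : ℂ))))

/-- `Im { exp(-j π t) ∑_{l ≠ p} (A_l / A_p) β_{s,l} }` with `t = δ_p - ν_p`. -/
def leakageIm (N : ℕ) (A : Fin L → ℂ) (m : Fin L → ℤ) (δ ν : Fin L → ℝ) (p : Fin L) (s : ℝ) : ℝ :=
  (Complex.exp (-(Real.pi * Complex.I * ((δ p - ν p : ℝ) : ℂ))) *
    ∑ l ∈ Finset.univ.erase p, A l / A p * beta N m δ ν p l s).im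

/-- The mean `μ_{f_p}` of the frequency error, given the previous residual estimates `ν`. -/
def meanError (N : ℕ) (A : Fin L → ℂ) (m : Fin L → ℤ) (δ ν : Fin L → ℝ) (p : Fin L) : ℝ :=
  Real.pi * gain (δ p - ν p) / (2 * N ^ 2) *
    ((1 - 2 * (δ p - ν p)) * leakageIm N A m δ ν p 1 +
      (1 + 2 * (δ p - ν p)) * leakageIm N A m δ ν p (-1))

/-- The variance `σ²_{f_p}`, given the previous residual estimates `ν`; here the signal to noise
ratio of component `p` is `ρ_p = |A_p|² / σ²`. -/
def varError (N : ℕ) (A : Fin L → ℂ) (σ : ℝ) (δ ν : Fin L → ℝ) (p : Fin L) : ℝ :=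
  Real.pi ^ 2 * gain (δ p - ν p) ^ 2 / (4 * (‖A p‖ ^ 2 / σ ^ 2) * N ^ 3) *
    (1 + 4 * (δ p - ν p) ^ 2)

end FreqEst

end

/-! Put `t = δ_p - ν_p` and `z = exp (2πi t / N)`. The two Fourier coefficients of a pure tone taken
half a bin to either side of the current location determine `z` exactly: the geometric sum gives
`D(t - 1/2) (z e^{-iπ/N} - 1) = D(t + 1/2) (z e^{iπ/N} - 1)`, a linear equation whose solution for
`z⁻¹` is `zInv`. The interpolation therefore errs only through what is added to these coefficients.
If the additions, relative to `A_p`, are at most `ε`, then `exists_interpolate_expansion` gives the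
error as the real-linear expression `π · gain t / 2 · linError` up to `O(ε (ε + 1/N))`. The
constants are uniform in `|t| ≤ 5/4`, since the limiting denominator has modulus `invGain t`, which
is bounded below there.

The additions are leakage and noise. Separation makes every cross kernel `O(1/N)`, so any bounded
amplitude estimates leave leakage `O(1/N)`, while the noise coefficients are of order `N^{-1/2}` in
probability.

Without noise, the prescribed amplitude estimates equal `A_l D(δ_l - ν_l) + O(1/N)`. Replacing them
by this main term changes the leakage by `O(N⁻²)` and turns the linearisation into exactly `N *
meanError`. Division by `N` gives the remainder `O(N⁻³)` (`exists_leakage_expansion`).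

With noise, standardising a residual error multiplies it by a factor of order `√N`. The leakage and
`N * meanError`, both `O(1/N)`, disappear separately, and only the linear noise term survives
(`exists_stdError_approx`). That term is evaluated at random locations. Summation by parts bounds
its variation by a multiple of `noiseSize`, which is bounded in probability, so the random locations
may be replaced by deterministic ones: the starting residuals in the first iteration, and the true
residuals later, because one step is already consistent (`Controlled.step`). At deterministic
locations the statistic is a real-linear form in Gaussian samples with an explicit characteristic
function. Asymptotic orthonormality of the exponentials involved gives its limit
(`tendstoInDistribution_noiseStat`), and Slutsky's theorem concludes. -/

namespace FreqEst

/-! ### Unit exponentials -/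

/-- The unit exponential `exp (2 π i x)`. -/
noncomputable def unitExp (x : ℝ) : ℂ := Complex.exp (2 * Real.pi * Complex.I * (x : ℂ))

lemma unitExp_eq (x : ℝ) : unitExp x = Complex.exp (((2 * Real.pi * x : ℝ) : ℂ) * Complex.I) := by
  unfold unitExp
  congr 1
  push_cast
  ring

@[simp] lemma norm_unitExp (x : ℝ) : ‖unitExp x‖ = 1 := by
  rw [unitExp_eq, Complex.norm_exp_ofReal_mul_I]

@[simp] lemma unitExp_zero : unitExp 0 = 1 := by simp [unitExp]

lemma unitExp_add (x y : ℝ) : unitExp (x + y) = unitExp x * unitExp y := by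
  simp only [unitExp, ← Complex.exp_add]
  congr 1
  push_cast
  ring

lemma unitExp_neg (x : ℝ) : unitExp (-x) = (unitExp x)⁻¹ := by
  simp only [unitExp, ← Complex.exp_neg]
  congr 1
  push_cast
  ring

lemma conj_unitExp (x : ℝ) : (starRingEnd ℂ) (unitExp x) = unitExp (-x) := by
  rw [unitExp_eq, unitExp_eq, ← Complex.exp_conj, map_mul, Complex.conj_ofReal, Complex.conj_I]
  congr 1
  push_cast
  ring

lemma unitExp_ne_zero (x : ℝ) : unitExp x ≠ 0 := Complex.exp_ne_zero _

lemma unitExp_sub (x y : ℝ) : unitExp (x - y) = unitExp x / unitExp y := by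
  rw [sub_eq_add_neg, unitExp_add, unitExp_neg, div_eq_mul_inv]

lemma unitExp_pow (x : ℝ) (n : ℕ) : unitExp x ^ n = unitExp (n * x) := by
  simp only [unitExp, ← Complex.exp_nat_mul]
  congr 1
  push_cast
  ring

@[simp] lemma unitExp_intCast (k : ℤ) : unitExp k = 1 := by
  rw [unitExp, Complex.exp_eq_one_iff]
  exact ⟨k, by push_cast; ring⟩

lemma unitExp_half : unitExp (1 / 2) = -1 := by
  rw [unitExp_eq, ← Complex.exp_pi_mul_I]
  congr 1
  push_cast
  ring

lemma norm_unitExp_sub_one (x : ℝ) : ‖unitExp x - 1‖ = 2 * |Real.sin (Real.pi * x)| := by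
  rw [unitExp_eq, mul_comm, Complex.norm_exp_I_mul_ofReal_sub_one, Real.norm_eq_abs, abs_mul]
  norm_num
  ring_nf

lemma norm_unitExp_sub_one_le (x : ℝ) : ‖unitExp x - 1‖ ≤ 2 * Real.pi * |x| := by
  rw [norm_unitExp_sub_one]
  have := Real.abs_sin_le_abs (x := Real.pi * x)
  rw [abs_mul, abs_of_pos Real.pi_pos] at this
  linarith

lemma norm_unitExp_sub_le (x y : ℝ) : ‖unitExp x - unitExp y‖ ≤ 2 * Real.pi * |x - y| := by
  have h : unitExp x - unitExp y = unitExp y * (unitExp (x - y) - 1) := by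
    rw [mul_sub, ← unitExp_add]
    simp
  rw [h, norm_mul, norm_unitExp, one_mul]
  exact norm_unitExp_sub_one_le _

lemma norm_two_pi_I_mul (x : ℝ) : ‖2 * Real.pi * Complex.I * (x : ℂ)‖ = 2 * Real.pi * |x| := by
  simp [abs_of_pos Real.pi_pos]

lemma norm_unitExp_sub_one_sub_le {x : ℝ} (hx : 2 * Real.pi * |x| ≤ 1) :
    ‖unitExp x - 1 - 2 * Real.pi * Complex.I * x‖ ≤ (2 * Real.pi * |x|) ^ 2 := by
  have := Complex.norm_exp_sub_one_sub_id_le (x := 2 * Real.pi * Complex.I * (x : ℂ))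
    (by rwa [norm_two_pi_I_mul])
  rwa [norm_two_pi_I_mul] at this

/-- A unit exponential at distance `Δ` from the integers is at distance at least `4 Δ` from `1`. -/
lemma le_norm_unitExp_sub_one {x Δ : ℝ} (h : ∀ k : ℤ, Δ ≤ |x - k|) : 4 * Δ ≤ ‖unitExp x - 1‖ := by
  -- Reducing modulo 1 puts the argument of the sine in `[-π/2, π/2]`, where Jordan's inequality
  -- `|sin y| ≥ 2|y|/π` applies.
  have hk : unitExp x = unitExp (x - round x) := by rw [unitExp_sub]; simp
  rw [hk, norm_unitExp_sub_one]
  have h1 := abs_sub_round x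
  have h2 : |Real.pi * (x - round x)| ≤ Real.pi / 2 := by
    rw [abs_mul, abs_of_pos Real.pi_pos]
    nlinarith [Real.pi_pos]
  have h3 := Real.mul_abs_le_abs_sin h2
  rw [abs_mul, abs_of_pos Real.pi_pos, ← mul_assoc, div_mul_cancel₀ _ Real.pi_pos.ne'] at h3
  linarith [h (round x)]

/-! ### The Dirichlet kernel -/

lemma dirichlet_eq (N : ℕ) (t : ℝ) :
    dirichlet N t = (1 / N) * ∑ n ∈ Finset.range N, unitExp (t / N) ^ n := by
  unfold dirichlet
  congr 1
  refine Finset.sum_congr rfl fun n _ => ?_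
  rw [unitExp, ← Complex.exp_nat_mul]
  congr 1
  push_cast
  ring

lemma norm_dirichlet_le (N : ℕ) (t : ℝ) : ‖dirichlet N t‖ ≤ 1 := by
  rw [dirichlet_eq, norm_mul]
  have h : ‖∑ n ∈ Finset.range N, unitExp (t / N) ^ n‖ ≤ N := by
    refine (norm_sum_le _ _).trans ?_
    simp
  rcases Nat.eq_zero_or_pos N with rfl | hN
  · simp
  · have hN' : (0 : ℝ) < N := by exact_mod_cast hN
    calc ‖(1 / N : ℂ)‖ * _ ≤ (1 / N : ℝ) * N := by
          gcongr
          simp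
      _ = 1 := by field_simp

/-- The geometric sum, kept in product form so that it stays valid when the ratio is 1. -/
lemma dirichlet_mul {N : ℕ} (hN : N ≠ 0) (t : ℝ) :
    dirichlet N t * (N * (unitExp (t / N) - 1)) = unitExp t - 1 := by
  have hN' : (N : ℂ) ≠ 0 := by exact_mod_cast hN
  have hN'' : (N : ℝ) ≠ 0 := by exact_mod_cast hN
  have h := mul_geom_sum (unitExp (t / N)) N
  rw [unitExp_pow, mul_div_cancel₀ _ hN''] at h
  rw [dirichlet_eq, ← h]
  field_simp

@[simp] lemma dirichlet_zero {N : ℕ} (hN : N ≠ 0) : dirichlet N 0 = 1 := by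
  have hN' : (N : ℂ) ≠ 0 := by exact_mod_cast hN
  simp [dirichlet_eq, hN']

/-- Away from the integers, in units of the sample size, the Dirichlet kernel is `O(1 / N)`. -/
lemma norm_dirichlet_le_of_separated {N : ℕ} (hN : N ≠ 0) {u Δ : ℝ} (hΔ : 0 < Δ)
    (h : ∀ k : ℤ, Δ ≤ |u / N - k|) : ‖dirichlet N u‖ ≤ 1 / (2 * Δ * N) := by
  have hN' : (0 : ℝ) < N := by positivity
  have h1 := le_norm_unitExp_sub_one h
  have h2 := congrArg norm (dirichlet_mul hN u)
  rw [norm_mul, norm_mul] at h2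
  have h3 : ‖unitExp u - 1‖ ≤ 2 := (norm_sub_le _ _).trans (by simp; norm_num)
  have h4 : ‖dirichlet N u‖ * (N * (4 * Δ)) ≤ 2 := by
    refine le_trans ?_ h3
    rw [← h2, Complex.norm_natCast]
    gcongr
  rw [le_div_iff₀ (by positivity)]
  linarith

/-- The pointwise limit of the Dirichlet kernel. -/
noncomputable def dirichletLim (s : ℝ) : ℂ :=
  Complex.exp (((Real.pi * s : ℝ) : ℂ) * Complex.I) * (Real.sinc (Real.pi * s) : ℂ)

/-- The limit of `dirichlet_mul`, with `N (unitExp (s / N) - 1)` replaced by `2πi s`. Using `sinc`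
makes `s = 0` harmless. -/
lemma dirichletLim_mul (s : ℝ) :
    dirichletLim s * (2 * Real.pi * Complex.I * s) = unitExp s - 1 := by
  rcases eq_or_ne s 0 with rfl | hs
  · simp
  have hπ : Real.pi * s ≠ 0 := mul_ne_zero Real.pi_ne_zero hs
  have hπ' : ((Real.pi * s : ℝ) : ℂ) ≠ 0 := by exact_mod_cast hπ
  have h1 : unitExp s = Complex.exp (((Real.pi * s : ℝ) : ℂ) * Complex.I) *
      Complex.exp (((Real.pi * s : ℝ) : ℂ) * Complex.I) := by
    rw [unitExp, ← Complex.exp_add]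
    congr 1
    push_cast
    ring
  have h2 : Complex.exp (((Real.pi * s : ℝ) : ℂ) * Complex.I) *
      Complex.exp (-(((Real.pi * s : ℝ) : ℂ)) * Complex.I) = 1 := by
    rw [← Complex.exp_add]
    simp
  rw [dirichletLim, Real.sinc_of_ne_zero hπ, h1, ← h2]
  rw [Complex.ofReal_div, Complex.ofReal_sin, Complex.sin]
  have h3 : (2 * Real.pi * Complex.I * s : ℂ) = 2 * Complex.I * ((Real.pi * s : ℝ) : ℂ) := by
    push_cast; ring
  rw [h3]
  field_simp
  linear_combination (Complex.exp (-(((Real.pi * s : ℝ) : ℂ) * Complex.I)) -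
    Complex.exp (((Real.pi * s : ℝ) : ℂ) * Complex.I)) * Complex.I_sq

/-- The product identities for the kernel and for its limit share their right-hand side. The
difference times `2πi s` is thus the kernel times `N` times the quadratic Taylor remainder of the
exponential. -/
lemma norm_dirichlet_sub_lim_le {N : ℕ} (hN : N ≠ 0) {s : ℝ} (hs : 2 * Real.pi * |s| ≤ N) :
    ‖dirichlet N s - dirichletLim s‖ ≤ 2 * Real.pi * |s| / N := by
  have hN' : (0 : ℝ) < N := by positivity
  have hNC : (N : ℂ) ≠ 0 := by exact_mod_cast hN
  rcases eq_or_ne s 0 with rfl | h0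
  · simp [dirichlet_zero hN, dirichletLim]
  have ha : 2 * Real.pi * |s / N| = 2 * Real.pi * |s| / N := by
    rw [abs_div, abs_of_pos hN']; ring
  have h1 := norm_unitExp_sub_one_sub_le (x := s / N) (by rw [ha]; exact (div_le_one hN').2 hs)
  rw [ha] at h1
  have hne : (2 * Real.pi * Complex.I * s : ℂ) ≠ 0 := by
    simp [Real.pi_ne_zero, h0]
  have hs0 : 0 < 2 * Real.pi * |s| := by positivity
  have h2 : (dirichlet N s - dirichletLim s) * (2 * Real.pi * Complex.I * s) =
      -(dirichlet N s * (N * (unitExp (s / N) - 1 -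
        2 * Real.pi * Complex.I * ((s / N : ℝ) : ℂ)))) := by
    rw [sub_mul, dirichletLim_mul, ← dirichlet_mul hN]
    push_cast
    field_simp
    ring
  have h3 := congrArg norm h2
  rw [norm_mul, norm_two_pi_I_mul, norm_neg, norm_mul, norm_mul, Complex.norm_natCast] at h3
  have h4 : ‖dirichlet N s - dirichletLim s‖ * (2 * Real.pi * |s|) ≤
      1 * (N * (2 * Real.pi * |s| / N) ^ 2) := by
    rw [h3]
    gcongr
    exact norm_dirichlet_le _ _
  refine le_of_mul_le_mul_right (h4.trans_eq ?_) hs0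
  field_simp

/-! ### The gain -/

/-- The reciprocal of `-π · gain`, as an entire function. -/
noncomputable def invGain (t : ℝ) : ℝ :=
  Real.sinc (Real.pi * (t - 1 / 2)) + Real.sinc (Real.pi * (t + 1 / 2))

lemma continuous_invGain : Continuous invGain := by
  unfold invGain
  have := Real.continuous_sinc
  fun_prop

lemma abs_invGain_le (t : ℝ) : |invGain t| ≤ 2 := by
  refine (abs_add_le _ _).trans ?_
  linarith [Real.abs_sinc_le_one (Real.pi * (t - 1 / 2)), Real.abs_sinc_le_one (Real.pi * (t + 1 / 2))]

/-- Both sines equal `± cos (π t)`, and the rest is the partial fraction decomposition of `1 / (1/4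
- t²)`. -/
lemma invGain_mul {t : ℝ} (h1 : t ≠ 1 / 2) (h2 : t ≠ -(1 / 2)) :
    invGain t * (Real.pi * (1 / 4 - t ^ 2)) = Real.cos (Real.pi * t) := by
  have h1' : t - 1 / 2 ≠ 0 := sub_ne_zero.2 h1
  have h2' : t + 1 / 2 ≠ 0 := by
    intro h; exact h2 (by linarith)
  have e1 : Real.sin (Real.pi * (t - 1 / 2)) = -Real.cos (Real.pi * t) := by
    rw [mul_sub, mul_one_div, Real.sin_sub_pi_div_two]
  have e2 : Real.sin (Real.pi * (t + 1 / 2)) = Real.cos (Real.pi * t) := by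
    rw [mul_add, mul_one_div, Real.sin_add_pi_div_two]
  have hπ := Real.pi_ne_zero
  rw [invGain, Real.sinc_of_ne_zero (mul_ne_zero hπ h1'), Real.sinc_of_ne_zero (mul_ne_zero hπ h2'),
    e1, e2]
  have e3 : (1 / 4 - t ^ 2 : ℝ) = -((t - 1 / 2) * (t + 1 / 2)) := by ring
  have e4 : t + 1 / 2 - (t - 1 / 2) = 1 := by ring
  rw [e3]
  generalize t - 1 / 2 = a at *
  generalize t + 1 / 2 = b at *
  field_simp
  linear_combination Real.cos (Real.pi * t) * e4

lemma invGain_of_abs_eq {t : ℝ} (h : |t| = 1 / 2) : invGain t = 1 := by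
  rcases (abs_eq (by norm_num)).1 h with rfl | rfl
  · rw [invGain]
    norm_num
    rw [Real.sinc_of_ne_zero Real.pi_ne_zero]
    simp
  · rw [invGain]
    norm_num
    rw [Real.sinc_of_ne_zero Real.pi_ne_zero]
    simp

/-- `cos (π t)` and `1/4 - t²` change sign together at `|t| = 1/2`, and the next zero of the cosine
is at `3/2`. The range `5/4` leaves room beyond the interval `[-1, 1]` in which the deterministic
residual differences lie. -/
lemma invGain_pos {t : ℝ} (ht : |t| ≤ 5 / 4) : 0 < invGain t := by
  by_cases h : |t| = 1 / 2
  · rw [invGain_of_abs_eq h]; norm_num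
  have h1 : t ≠ 1 / 2 := by rintro rfl; norm_num at h
  have h2 : t ≠ -(1 / 2) := by rintro rfl; norm_num at h
  have h3 := invGain_mul h1 h2
  have hcos : Real.cos (Real.pi * t) = Real.cos (Real.pi * |t|) := by
    rw [← Real.cos_abs, abs_mul, abs_of_pos Real.pi_pos]
  have hπ := Real.pi_pos
  rcases lt_or_gt_of_ne h with h | h
  · have hc : 0 < Real.cos (Real.pi * t) := by
      rw [hcos]
      apply Real.cos_pos_of_mem_Ioo
      constructor <;> nlinarith [abs_nonneg t]
    have : 0 < 1 / 4 - t ^ 2 := by rw [← sq_abs]; nlinarith [abs_nonneg t]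
    rw [← h3] at hc
    exact (pos_iff_pos_of_mul_pos hc).2 (by positivity)
  · have hc : Real.cos (Real.pi * t) < 0 := by
      rw [hcos]
      apply Real.cos_neg_of_pi_div_two_lt_of_lt <;> nlinarith [abs_nonneg t]
    have : 1 / 4 - t ^ 2 < 0 := by rw [← sq_abs]; nlinarith [abs_nonneg t]
    rw [← h3] at hc
    have h5 : Real.pi * (1 / 4 - t ^ 2) < 0 := by nlinarith
    by_contra hneg
    push Not at hneg
    nlinarith

lemma gain_eq {t : ℝ} (ht : |t| ≤ 5 / 4) : gain t = -(1 / (Real.pi * invGain t)) := by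
  have hp := invGain_pos ht
  have hπ := Real.pi_pos
  unfold gain
  split_ifs with h
  · rw [invGain_of_abs_eq h, mul_one]
  · have h1 : t ≠ 1 / 2 := by rintro rfl; norm_num at h
    have h2 : t ≠ -(1 / 2) := by rintro rfl; norm_num at h
    rw [← invGain_mul h1 h2]
    have : (1 / 4 - t ^ 2) ≠ 0 := by
      intro h3
      have : (t - 1 / 2) * (t + 1 / 2) = 0 := by linarith
      rcases mul_eq_zero.1 this with h4 | h4
      · exact h1 (by linarith)
      · exact h2 (by linarith)
    have h3 : t ^ 2 - 1 / 4 = -(1 / 4 - t ^ 2) := by ring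
    rw [h3]
    generalize 1 / 4 - t ^ 2 = a at *
    field_simp

lemma exists_le_invGain : ∃ c : ℝ, 0 < c ∧ ∀ t : ℝ, |t| ≤ 5 / 4 → c ≤ invGain t := by
  obtain ⟨x, hx, hmin⟩ := (isCompact_Icc (a := -(5 / 4 : ℝ)) (b := 5 / 4)).exists_isMinOn
    ⟨0, by norm_num⟩ continuous_invGain.continuousOn
  exact ⟨invGain x, invGain_pos (abs_le.2 hx), fun t ht => hmin (abs_le.1 ht)⟩

/-- This is the limit of the denominator `S₊ - S₋` of the interpolation. The half-bin shifts turn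
the phases into `∓i e^{iπt}`, so the two sincs add up instead of cancelling. -/
lemma dirichletLim_sub (t : ℝ) : dirichletLim (t - 1 / 2) - dirichletLim (t + 1 / 2) =
    -(Complex.I * Complex.exp (Real.pi * Complex.I * t) * invGain t) := by
  have h1 : Complex.exp (((Real.pi * (t - 1 / 2) : ℝ) : ℂ) * Complex.I) =
      -(Complex.I * Complex.exp (Real.pi * Complex.I * t)) := by
    have : ((Real.pi * (t - 1 / 2) : ℝ) : ℂ) * Complex.I =
      Real.pi * Complex.I * t + -(Real.pi / 2 * Complex.I) := by push_cast; ring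
    rw [this, Complex.exp_add, Complex.exp_neg, Complex.exp_pi_div_two_mul_I, Complex.inv_I]
    ring
  have h2 : Complex.exp (((Real.pi * (t + 1 / 2) : ℝ) : ℂ) * Complex.I) =
      Complex.I * Complex.exp (Real.pi * Complex.I * t) := by
    have : ((Real.pi * (t + 1 / 2) : ℝ) : ℂ) * Complex.I =
      Real.pi * Complex.I * t + (Real.pi / 2 * Complex.I) := by push_cast; ring
    rw [this, Complex.exp_add, Complex.exp_pi_div_two_mul_I]
    ring
  rw [dirichletLim, dirichletLim, h1, h2, invGain]
  push_cast
  ring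

end FreqEst

namespace FreqEst

/-! ### Perturbation of the interpolation estimator -/

/-- The linearisation of the interpolation estimator, up to the factor `π · gain / 2`. -/
noncomputable def linError (t : ℝ) (ep em : ℂ) : ℝ :=
  (Complex.exp (-(Real.pi * Complex.I * (t : ℂ))) *
    ((1 - 2 * t : ℝ) * ep + (1 + 2 * t : ℝ) * em)).im

lemma unitExp_sub_half (t : ℝ) : unitExp (t - 1 / 2) = -unitExp t := by
  rw [unitExp_sub, unitExp_half]; ring

lemma unitExp_add_half (t : ℝ) : unitExp (t + 1 / 2) = -unitExp t := by
  rw [unitExp_add, unitExp_half]; ring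

/-- Over the common denominator, `cos ∓ i sin` combine into the half-bin rotations. This form shows
`zInv` as the solution of a linear equation. -/
lemma zInv_eq (N : ℕ) {Sp Sm : ℂ} (h : Sp - Sm ≠ 0) :
    zInv N Sp Sm =
      (unitExp (-(1 / 2) / N) * Sp - unitExp ((1 / 2) / N) * Sm) / (Sp - Sm) := by
  have e1 : unitExp ((1 / 2) / N) =
      (Real.cos (Real.pi / N) : ℂ) + (Real.sin (Real.pi / N) : ℂ) * Complex.I := by
    rw [unitExp_eq, Complex.exp_mul_I, ← Complex.ofReal_cos, ← Complex.ofReal_sin]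
    have : 2 * Real.pi * (1 / 2 / N) = Real.pi / N := by ring
    rw [this]
  have e2 : unitExp (-(1 / 2) / N) =
      (Real.cos (Real.pi / N) : ℂ) - (Real.sin (Real.pi / N) : ℂ) * Complex.I := by
    have : -(1 / 2) / (N : ℝ) = -((1 / 2) / N) := by ring
    rw [this, ← conj_unitExp, e1, map_add, map_mul, Complex.conj_ofReal, Complex.conj_ofReal,
      Complex.conj_I]
    ring
  simp only [zInv]
  rw [e1, e2]
  field_simp
  ring

/-- The relative error of `zInv` at perturbed Dirichlet coefficients. -/
lemma zInv_dirichlet {N : ℕ} (hN : N ≠ 0) (t : ℝ) {ep em : ℂ}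
    (h : dirichlet N (t - 1 / 2) + ep - (dirichlet N (t + 1 / 2) + em) ≠ 0) :
    zInv N (dirichlet N (t - 1 / 2) + ep) (dirichlet N (t + 1 / 2) + em) =
      unitExp (-(t / N)) * (1 + (ep * (unitExp ((t - 1 / 2) / N) - 1) -
        em * (unitExp ((t + 1 / 2) / N) - 1)) /
          (dirichlet N (t - 1 / 2) + ep - (dirichlet N (t + 1 / 2) + em))) := by
  have hNC : (N : ℂ) ≠ 0 := by exact_mod_cast hN
  have h1 := dirichlet_mul hN (t - 1 / 2)
  have h2 := dirichlet_mul hN (t + 1 / 2)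
  rw [unitExp_sub_half] at h1
  rw [unitExp_add_half] at h2
  -- This identity is the exactness of the interpolation: shifts by `±1/2` give the same `unitExp`,
  -- so both products agree and the unperturbed terms cancel.
  have h3 : dirichlet N (t - 1 / 2) * (unitExp ((t - 1 / 2) / N) - 1) =
      dirichlet N (t + 1 / 2) * (unitExp ((t + 1 / 2) / N) - 1) := by
    apply mul_left_cancel₀ hNC
    linear_combination h1 - h2
  have e1 : unitExp ((t - 1 / 2) / N) = unitExp (t / N) * unitExp (-(1 / 2) / N) := by
    rw [← unitExp_add]; congr 1; ring
  have e2 : unitExp ((t + 1 / 2) / N) = unitExp (t / N) * unitExp ((1 / 2) / N) := by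
    rw [← unitExp_add]; congr 1; ring
  rw [zInv_eq N h, unitExp_neg]
  rw [e1, e2] at h3 ⊢
  have hz := unitExp_ne_zero (t / N)
  generalize dirichlet N (t - 1 / 2) = a at *
  generalize dirichlet N (t + 1 / 2) = b at *
  generalize unitExp (t / N) = z at *
  generalize unitExp (-(1 / 2) / N) = u at *
  generalize unitExp (1 / 2 / N) = v at *
  rw [div_eq_iff h, mul_assoc, add_mul, div_mul_cancel₀ _ h, one_mul, eq_inv_mul_iff_mul_eq₀ hz]
  linear_combination h3

lemma abs_im_log_one_add_sub_le {r : ℂ} (hr : ‖r‖ ≤ 1 / 2) :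
    |(Complex.log (1 + r)).im - r.im| ≤ ‖r‖ ^ 2 := by
  rw [← Complex.sub_im]
  refine (Complex.abs_im_le_norm _).trans
    ((Complex.norm_log_one_add_sub_self_le (by linarith)).trans ?_)
  have h : (1 - ‖r‖)⁻¹ ≤ 2 := by
    rw [inv_le_comm₀ (by linarith) (by norm_num)]
    linarith
  nlinarith [sq_nonneg ‖r‖]

/-- No branch is crossed: the two arguments are at most `π/2` and `1` in absolute value, and their
sum stays below `π`. -/
lemma im_log_unitExp_mul {x : ℝ} {r : ℂ} (hx : |x| ≤ 1 / 4) (hr : ‖r‖ ≤ 1 / 2) :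
    (Complex.log (unitExp x * (1 + r))).im = 2 * Real.pi * x + (Complex.log (1 + r)).im := by
  have hπ := Real.pi_gt_three
  have hx' := abs_le.1 hx
  have e1 : Complex.arg (unitExp x) = 2 * Real.pi * x := by
    rw [unitExp_eq, Complex.arg_exp_mul_I, toIocMod_eq_self]
    constructor <;> nlinarith
  have hlog := abs_im_log_one_add_sub_le hr
  have him := Complex.abs_im_le_norm r
  have h1 : |(Complex.log (1 + r)).im| ≤ 1 := by
    have := abs_sub_abs_le_abs_sub (Complex.log (1 + r)).im r.im
    nlinarith [norm_nonneg r]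
  have h1' := abs_le.1 h1
  have hne : 1 + r ≠ 0 := by
    intro h
    have : r = -1 := by linear_combination h
    rw [this] at hr
    norm_num at hr
  simp only [Complex.log_im] at h1' ⊢
  rw [Complex.arg_mul (unitExp_ne_zero _) hne, e1]
  rw [e1]
  constructor <;> nlinarith

lemma mul_abs_add_le {n x y a b : ℝ} (hn : 0 < n) (hx : |x| ≤ a / n) (hy : |y| ≤ b / n) :
    n / (2 * Real.pi) * |x + y| ≤ a + b := by
  have h := (abs_add_le x y).trans (add_le_add hx hy)
  calc n / (2 * Real.pi) * |x + y| ≤ n / 1 * (a / n + b / n) := by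
        gcongr
        linarith [Real.pi_gt_three]
    _ = a + b := by field_simp

set_option maxHeartbeats 1000000 in
/-- First-order expansion of the interpolation estimator at perturbed Dirichlet coefficients. -/
lemma exists_interpolate_expansion : ∃ C η : ℝ, 0 < C ∧ 0 < η ∧ ∃ N₀ : ℕ, ∀ N ≥ N₀,
    ∀ (t ε : ℝ) (ep em : ℂ), |t| ≤ 5 / 4 → ‖ep‖ ≤ ε → ‖em‖ ≤ ε → ε ≤ η →
    |interpolate N (dirichlet N (t - 1 / 2) + ep) (dirichlet N (t + 1 / 2) + em) - t -
      Real.pi * gain t / 2 * linError t ep em| ≤ C * (ε * (ε + 1 / N)) := by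
  obtain ⟨c, hc, hq⟩ := exists_le_invGain
  -- Since `2π · 7/4 < 11`, the rotations differ from 1 by at most `11/N`. With `N ≥ 88/c` and `ε ≤
  -- c/8`, the denominator is within `c/4 + c/4` of its limit, hence at least `c/2` in norm. The
  -- three constants come from linearising the numerator, replacing the denominator by its limit,
  -- and the quadratic remainder of the logarithm.
  refine ⟨484 / c + 968 / c ^ 2 + (44 / c) ^ 2, c / 8, by positivity, by positivity,
    ⌈88 / c⌉₊ + 20, fun N hN t ε ep em ht hep hem hε => ?_⟩
  have hN1 : 88 / c ≤ N := (Nat.le_ceil _).trans (by exact_mod_cast (by omega : ⌈88 / c⌉₊ ≤ N))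
  have hN2 : (20 : ℝ) ≤ N := by exact_mod_cast (by omega : 20 ≤ N)
  have hN0 : N ≠ 0 := by omega
  have hNpos : (0 : ℝ) < N := by linarith
  have hε0 : 0 ≤ ε := (norm_nonneg _).trans hep
  have hπ := Real.pi_pos
  have hπ2 := Real.pi_lt_d4
  have ht' := abs_le.1 ht
  have hqt := hq t ht
  have hs1 : |t - 1 / 2| ≤ 7 / 4 := abs_le.2 ⟨by linarith, by linarith⟩
  have hs2 : |t + 1 / 2| ≤ 7 / 4 := abs_le.2 ⟨by linarith, by linarith⟩
  have hb1 : 2 * Real.pi * |t - 1 / 2| ≤ 11 := by nlinarith [abs_nonneg (t - 1 / 2)]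
  have hb2 : 2 * Real.pi * |t + 1 / 2| ≤ 11 := by nlinarith [abs_nonneg (t + 1 / 2)]
  set Den := dirichlet N (t - 1 / 2) + ep - (dirichlet N (t + 1 / 2) + em) with hDen
  set d : ℂ := -(Complex.I * Complex.exp (Real.pi * Complex.I * t) * invGain t) with hd
  have hexp : ‖Complex.exp (Real.pi * Complex.I * t)‖ = 1 := by
    have : (Real.pi * Complex.I * t : ℂ) = ((Real.pi * t : ℝ) : ℂ) * Complex.I := by
      push_cast; ring
    rw [this, Complex.norm_exp_ofReal_mul_I]
  have hdn : ‖d‖ = invGain t := by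
    rw [hd, norm_neg, norm_mul, norm_mul, Complex.norm_I, hexp, Complex.norm_real,
      Real.norm_of_nonneg (by linarith)]
    ring
  have hdiff : ‖Den - d‖ ≤ 22 / N + 2 * ε := by
    have h1 := (norm_dirichlet_sub_lim_le hN0 (by linarith : 2 * Real.pi * |t - 1 / 2| ≤ N)).trans
      (div_le_div_of_nonneg_right hb1 hNpos.le)
    have h2 := (norm_dirichlet_sub_lim_le hN0 (by linarith : 2 * Real.pi * |t + 1 / 2| ≤ N)).trans
      (div_le_div_of_nonneg_right hb2 hNpos.le)
    have h3 : Den - d = (dirichlet N (t - 1 / 2) - dirichletLim (t - 1 / 2)) -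
        (dirichlet N (t + 1 / 2) - dirichletLim (t + 1 / 2)) + (ep - em) := by
      rw [hd, ← dirichletLim_sub]; ring
    rw [h3]
    refine (norm_add_le _ _).trans ?_
    have h4 := norm_sub_le (dirichlet N (t - 1 / 2) - dirichletLim (t - 1 / 2))
      (dirichlet N (t + 1 / 2) - dirichletLim (t + 1 / 2))
    have h5 := norm_sub_le ep em
    have h6 : (22 : ℝ) / N = 11 / N + 11 / N := by ring
    linarith
  have h22 : (22 : ℝ) / N ≤ c / 4 := by
    rw [div_le_iff₀ hNpos]
    rw [div_le_iff₀ hc] at hN1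
    nlinarith
  have hDenlb : c / 2 ≤ ‖Den‖ := by
    have := norm_sub_norm_le d Den
    rw [norm_sub_rev d Den] at this
    linarith
  have hDen0 : Den ≠ 0 := norm_pos_iff.1 (by linarith)
  have hd0 : d ≠ 0 := norm_pos_iff.1 (by linarith)
  set am := unitExp ((t - 1 / 2) / N) - 1 with ham
  set ap := unitExp ((t + 1 / 2) / N) - 1 with hap
  have hsN (s : ℝ) : 2 * Real.pi * |s / N| = 2 * Real.pi * |s| / N := by
    rw [abs_div, abs_of_pos hNpos]; ring
  have hamn : ‖am‖ ≤ 11 / N := by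
    refine (norm_unitExp_sub_one_le _).trans ?_
    rw [hsN]; gcongr
  have hapn : ‖ap‖ ≤ 11 / N := by
    refine (norm_unitExp_sub_one_le _).trans ?_
    rw [hsN]; gcongr
  have h11 : (11 : ℝ) / N ≤ 1 := by rw [div_le_one hNpos]; linarith
  have ham2 : ‖am - 2 * Real.pi * Complex.I * (((t - 1 / 2) / N : ℝ) : ℂ)‖ ≤ (11 / N) ^ 2 := by
    refine (norm_unitExp_sub_one_sub_le ?_).trans ?_
    · rw [hsN]; exact (div_le_div_of_nonneg_right hb1 hNpos.le).trans h11
    · rw [hsN]; gcongr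
  have hap2 : ‖ap - 2 * Real.pi * Complex.I * (((t + 1 / 2) / N : ℝ) : ℂ)‖ ≤ (11 / N) ^ 2 := by
    refine (norm_unitExp_sub_one_sub_le ?_).trans ?_
    · rw [hsN]; exact (div_le_div_of_nonneg_right hb2 hNpos.le).trans h11
    · rw [hsN]; gcongr
  set num := ep * am - em * ap with hnum
  set num0 : ℂ := ep * (2 * Real.pi * Complex.I * (((t - 1 / 2) / N : ℝ) : ℂ)) -
    em * (2 * Real.pi * Complex.I * (((t + 1 / 2) / N : ℝ) : ℂ)) with hnum0
  have hnumn : ‖num‖ ≤ 22 * ε / N := by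
    refine (norm_sub_le _ _).trans ?_
    rw [norm_mul, norm_mul]
    have : 22 * ε / N = ε * (11 / N) + ε * (11 / N) := by ring
    rw [this]
    gcongr
  have hnum0n : ‖num0‖ ≤ 22 * ε / N := by
    refine (norm_sub_le _ _).trans ?_
    rw [norm_mul ep, norm_mul em, norm_two_pi_I_mul, norm_two_pi_I_mul, hsN, hsN]
    have : 22 * ε / N = ε * (11 / N) + ε * (11 / N) := by ring
    rw [this]
    gcongr
  have hnumdiff : ‖num - num0‖ ≤ 2 * ε * (11 / N) ^ 2 := by
    have : num - num0 = ep * (am - 2 * Real.pi * Complex.I * (((t - 1 / 2) / N : ℝ) : ℂ)) -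
        em * (ap - 2 * Real.pi * Complex.I * (((t + 1 / 2) / N : ℝ) : ℂ)) := by
      rw [hnum, hnum0]; ring
    rw [this]
    refine (norm_sub_le _ _).trans ?_
    rw [norm_mul, norm_mul]
    have : 2 * ε * (11 / N : ℝ) ^ 2 = ε * (11 / N) ^ 2 + ε * (11 / N) ^ 2 := by ring
    rw [this]
    gcongr
  have hrn : ‖num / Den‖ ≤ 44 / c * (ε / N) := by
    rw [norm_div, div_le_iff₀ (by linarith)]
    calc ‖num‖ ≤ 22 * ε / N := hnumn
      _ = 44 / c * (ε / N) * (c / 2) := by ring_nf; field_simp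
      _ ≤ _ := by gcongr
  have hεN : ε / N ≤ c / 8 / 20 := by gcongr
  have hr12 : ‖num / Den‖ ≤ 1 / 2 := by
    refine hrn.trans ?_
    calc 44 / c * (ε / N) ≤ 44 / c * (c / 8 / 20) := by gcongr
      _ = 44 / 160 := by field_simp; norm_num
      _ ≤ 1 / 2 := by norm_num
  have hrdiff : ‖num / Den - num0 / d‖ ≤ (484 / c + 968 / c ^ 2) * (ε * (ε + 1 / N)) / N := by
    have e : num / Den - num0 / d = (num - num0) / Den + num0 * (d - Den) / (Den * d) := by
      field_simp; ring
    have h1 : ‖(num - num0) / Den‖ ≤ 2 * ε * (11 / N) ^ 2 / (c / 2) := by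
      rw [norm_div]; gcongr
    have h2 : ‖num0 * (d - Den) / (Den * d)‖ ≤
        22 * ε / N * (22 / N + 2 * ε) / (c / 2 * c) := by
      rw [norm_div, norm_mul, norm_mul, norm_sub_rev d, hdn]; gcongr
    rw [e]
    refine (norm_add_le _ _).trans ((add_le_add h1 h2).trans ?_)
    have : (484 / c + 968 / c ^ 2) * (ε * (ε + 1 / N)) / N -
        (2 * ε * (11 / N) ^ 2 / (c / 2) + 22 * ε / N * (22 / N + 2 * ε) / (c / 2 * c)) =
        484 / c * ε * ε / N + 880 / c ^ 2 * ε * ε / N := by field_simp; ring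
    have h3 : 0 ≤ 484 / c * ε * ε / N + 880 / c ^ 2 * ε * ε / N := by positivity
    linarith
  have hz := zInv_dirichlet hN0 t (ep := ep) (em := em) hDen0
  have htN : |-(t / N)| ≤ 1 / 4 := by
    rw [abs_neg, abs_div, abs_of_pos hNpos, div_le_iff₀ hNpos]; linarith
  have hint : interpolate N (dirichlet N (t - 1 / 2) + ep) (dirichlet N (t + 1 / 2) + em) =
      t - N / (2 * Real.pi) * (Complex.log (1 + num / Den)).im := by
    rw [interpolate, hz, im_log_unitExp_mul htN hr12]
    field_simp
    ring
  -- The phase `-i e^{iπt}` of the limiting denominator cancels the `i` from the numerator and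
  -- leaves the factor `e^{-iπt}` of `linError`.
  have hlin : Real.pi * gain t / 2 * linError t ep em =
      -(N / (2 * Real.pi) * (num0 / d).im) := by
    have e1 : num0 / d = ((2 * Real.pi / N * (1 / (2 * invGain t)) : ℝ) : ℂ) *
        (Complex.exp (-(Real.pi * Complex.I * (t : ℂ))) *
          ((1 - 2 * t : ℝ) * ep + (1 + 2 * t : ℝ) * em)) := by
      have hqC : (invGain t : ℂ) ≠ 0 := by
        exact_mod_cast (by linarith : (0 : ℝ) < invGain t).ne'
      have hNC : (N : ℂ) ≠ 0 := by exact_mod_cast hN0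
      have hex := Complex.exp_ne_zero (Real.pi * Complex.I * t)
      rw [hnum0, hd, Complex.exp_neg]
      push_cast
      field_simp
      ring
    rw [e1, Complex.im_ofReal_mul, gain_eq ht, linError]
    have hq0 : invGain t ≠ 0 := by linarith
    field_simp
  have hfin : interpolate N (dirichlet N (t - 1 / 2) + ep) (dirichlet N (t + 1 / 2) + em) - t -
      Real.pi * gain t / 2 * linError t ep em =
      -(N / (2 * Real.pi) * (((Complex.log (1 + num / Den)).im - (num / Den).im) +
        (num / Den - num0 / d).im)) := by
    rw [hint, hlin, Complex.sub_im]; ring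
  rw [hfin, abs_neg, abs_mul, abs_of_pos (by positivity)]
  have hA := abs_im_log_one_add_sub_le hr12
  have hB := (Complex.abs_im_le_norm (num / Den - num0 / d)).trans hrdiff
  have hC : ‖num / Den‖ ^ 2 ≤ (44 / c) ^ 2 * (ε * (ε + 1 / N)) / N := by
    have hN1 : (1 : ℝ) / N ≤ 1 := by rw [div_le_one hNpos]; linarith
    have h0 : (0 : ℝ) ≤ 1 / N := by positivity
    have h1 : ε * (1 / N) ≤ ε + 1 / N := by nlinarith
    calc ‖num / Den‖ ^ 2 ≤ (44 / c * (ε / N)) ^ 2 := pow_le_pow_left₀ (norm_nonneg _) hrn 2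
      _ = (44 / c) ^ 2 * (ε * (ε * (1 / N))) / N := by ring
      _ ≤ (44 / c) ^ 2 * (ε * (ε + 1 / N)) / N :=
        div_le_div_of_nonneg_right (mul_le_mul_of_nonneg_left
          (mul_le_mul_of_nonneg_left h1 hε0) (sq_nonneg _)) hNpos.le
  refine (mul_abs_add_le hNpos (hA.trans hC) hB).trans_eq ?_
  ring

end FreqEst

namespace FreqEst

variable {L : ℕ}

/-! ### Fourier coefficients of the model -/

lemma fourierCoeff_eq (N : ℕ) (x : ℕ → ℂ) (k : ℝ) :
    fourierCoeff N x k = (1 / N) * ∑ n ∈ Finset.range N, x n * unitExp (-(k * n / N)) := by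
  unfold fourierCoeff unitExp
  congr 1
  refine Finset.sum_congr rfl fun n _ => ?_
  congr 2
  push_cast
  ring

lemma fourierCoeff_add (N : ℕ) (x y : ℕ → ℂ) (k : ℝ) :
    fourierCoeff N (fun n => x n + y n) k = fourierCoeff N x k + fourierCoeff N y k := by
  simp only [fourierCoeff, add_mul, Finset.sum_add_distrib, mul_add]

lemma fourierCoeff_tones {N : ℕ} (hN : N ≠ 0) (A : Fin L → ℂ) (f : Fin L → ℝ) (k : ℝ) :
    fourierCoeff N (tones A f) k = ∑ l, A l * dirichlet N (N * f l - k) := by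
  have hN' : (N : ℝ) ≠ 0 := by exact_mod_cast hN
  simp only [fourierCoeff_eq, dirichlet_eq, tones, Finset.mul_sum, Finset.sum_mul]
  rw [Finset.sum_comm]
  refine Finset.sum_congr rfl fun l _ => Finset.sum_congr rfl fun n _ => ?_
  have : Complex.exp (2 * Real.pi * Complex.I * ((f l : ℂ) * n)) = unitExp (f l * n) := by
    rw [unitExp]; push_cast; rfl
  rw [this, unitExp_pow]
  have : unitExp (n * ((N * f l - k) / N)) = unitExp (f l * n) * unitExp (-(k * n / N)) := by
    rw [← unitExp_add]
    congr 1
    field_simp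
    ring
  rw [this]
  ring

/-- The leakage of the components `l ≠ p` that is left in the corrected coefficient. -/
noncomputable def leakError (N : ℕ) (A : Fin L → ℂ) (m : Fin L → ℤ) (δ : Fin L → ℝ)
    (e : Estimates L) (p : Fin L) (s : ℝ) : ℂ :=
  ∑ l ∈ Finset.univ.erase p,
    (A l * dirichlet N (((m l - m p : ℤ) : ℝ) + δ l - e.residual p - s / 2) -
      e.amplitude l * dirichlet N (((m l - m p : ℤ) : ℝ) + e.residual l - e.residual p - s / 2))

lemma cleanCoeff_eq {N : ℕ} (hN : N ≠ 0) (A : Fin L → ℂ) {f δ : Fin L → ℝ} {m : Fin L → ℤ}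
    (hδ : ∀ l, δ l = N * f l - m l) (y : ℕ → ℂ) (e : Estimates L) (p : Fin L) (s : ℝ) :
    cleanCoeff N m (fun n => tones A f n + y n) e p s =
      A p * dirichlet N (δ p - e.residual p - s / 2) + (leakError N A m δ e p s +
        fourierCoeff N y (m p + e.residual p + s / 2)) := by
  rw [cleanCoeff, fourierCoeff_add, fourierCoeff_tones hN, leakage, leakError,
    Finset.sum_sub_distrib, ← Finset.add_sum_erase _ _ (Finset.mem_univ p)]
  have h1 : (N : ℝ) * f p - (m p + e.residual p + s / 2) = δ p - e.residual p - s / 2 := by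
    rw [hδ]; ring
  have h2 (l : Fin L) : (N : ℝ) * f l - (m p + e.residual p + s / 2) =
      ((m l - m p : ℤ) : ℝ) + δ l - e.residual p - s / 2 := by
    rw [hδ]; push_cast; ring
  simp only [h1, h2]
  ring

lemma newAmplitude_eq {N : ℕ} (hN : N ≠ 0) (A : Fin L → ℂ) {f δ : Fin L → ℝ} {m : Fin L → ℤ}
    (hδ : ∀ l, δ l = N * f l - m l) (ν : Fin L → ℝ) (b : Fin L → ℂ) (p : Fin L) :
    newAmplitude N m (tones A f) ν b p = A p * dirichlet N (δ p - ν p) +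
      ∑ l ∈ Finset.univ.erase p, (A l * dirichlet N (((m l - m p : ℤ) : ℝ) + δ l - ν p) -
        b l * dirichlet N (((m l - m p : ℤ) : ℝ) + ν l - ν p)) := by
  rw [newAmplitude, fourierCoeff_tones hN, Finset.sum_sub_distrib,
    ← Finset.add_sum_erase _ _ (Finset.mem_univ p)]
  have h1 : (N : ℝ) * f p - (m p + ν p) = δ p - ν p := by
    rw [hδ]; ring
  have h2 (l : Fin L) : (N : ℝ) * f l - (m p + ν p) = ((m l - m p : ℤ) : ℝ) + δ l - ν p := by
    rw [hδ]; push_cast; ring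
  simp only [h1, h2]
  ring

/-- The estimator depends only on the ratio of the coefficients, so the amplitude of component `p`
can be normalised to 1. -/
lemma interpolate_mul (N : ℕ) {a : ℂ} (ha : a ≠ 0) (Sp Sm : ℂ) :
    interpolate N (a * Sp) (a * Sm) = interpolate N Sp Sm := by
  have : (a * Sp + a * Sm) / (a * Sp - a * Sm) = (Sp + Sm) / (Sp - Sm) := by
    rw [← mul_add, ← mul_sub, mul_div_mul_left _ _ ha]
  simp only [interpolate, zInv, this]

/-- The total perturbation of the corrected coefficient, relative to the amplitude. -/
noncomputable def relError (N : ℕ) (A : Fin L → ℂ) (m : Fin L → ℤ) (δ : Fin L → ℝ)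
    (e : Estimates L) (y : ℕ → ℂ) (p : Fin L) (s : ℝ) : ℂ :=
  (leakError N A m δ e p s + fourierCoeff N y (m p + e.residual p + s / 2)) / A p

lemma newResidual_eq {N : ℕ} (hN : N ≠ 0) (A : Fin L → ℂ) {f δ : Fin L → ℝ} {m : Fin L → ℤ}
    (hδ : ∀ l, δ l = N * f l - m l) (y : ℕ → ℂ) (e : Estimates L) {p : Fin L} (hA : A p ≠ 0) :
    newResidual N m (fun n => tones A f n + y n) e p =
      e.residual p + interpolate N
        (dirichlet N (δ p - e.residual p - 1 / 2) + relError N A m δ e y p 1)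
        (dirichlet N (δ p - e.residual p + 1 / 2) + relError N A m δ e y p (-1)) := by
  have h : δ p - e.residual p + 1 / 2 = δ p - e.residual p - -1 / 2 := by ring
  rw [newResidual, cleanCoeff_eq hN A hδ, cleanCoeff_eq hN A hδ, h,
    ← interpolate_mul N hA (dirichlet N (δ p - e.residual p - 1 / 2) + _)]
  simp only [relError, mul_add, mul_div_cancel₀ _ hA]

/-! ### Leakage between separated components -/

/-- A displacement of four bins moves the normalised frequency by at most `4/N ≤ Δ/2`. Rounding to
bins, residual errors and half-bin shifts all fit into this allowance. -/
lemma separation_shift {N : ℕ} {fp fl u Δ : ℝ} (hΔ : 0 < Δ) (hN : 8 / Δ ≤ N)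
    (h : ∀ k : ℤ, Δ ≤ |fl - fp - k|) (hu : |u - N * (fl - fp)| ≤ 4) (k : ℤ) :
    Δ / 2 ≤ |u / N - k| := by
  have hN0 : (0 : ℝ) < N := lt_of_lt_of_le (by positivity) hN
  have h1 : fl - fp - k = u / N - k + -((u - N * (fl - fp)) / N) := by
    field_simp; ring
  have h2 : |(u - N * (fl - fp)) / N| ≤ Δ / 2 := by
    rw [abs_div, abs_of_pos hN0, div_le_iff₀ hN0]
    rw [div_le_iff₀ hΔ] at hN
    linarith
  have h3 := abs_add_le (u / N - k) (-((u - N * (fl - fp)) / N))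
  rw [← h1, abs_neg] at h3
  linarith [h k]

lemma norm_dirichlet_le_of_shift {N : ℕ} {fp fl u Δ : ℝ} (hΔ : 0 < Δ) (hN : 8 / Δ ≤ N)
    (h : ∀ k : ℤ, Δ ≤ |fl - fp - k|) (hu : |u - N * (fl - fp)| ≤ 4) :
    ‖dirichlet N u‖ ≤ 1 / (Δ * N) := by
  have hN0 : (0 : ℝ) < N := lt_of_lt_of_le (by positivity) hN
  have hN1 : N ≠ 0 := by
    rintro rfl
    simp at hN0
  refine (norm_dirichlet_le_of_separated hN1 (half_pos hΔ)
    (separation_shift hΔ hN h hu)).trans_eq ?_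
  congr 1
  ring

/-- The frequencies, bins and residuals of a model whose frequencies are `Δ`-separated. -/
structure SeparatedAt (N : ℕ) (f δ : Fin L → ℝ) (m : Fin L → ℤ) (Δ : ℝ) : Prop where
  pos : 0 < Δ
  large : 8 / Δ ≤ N
  sep : ∀ p l : Fin L, p ≠ l → ∀ k : ℤ, Δ ≤ |f p - f l - k|
  residual_eq : ∀ l, δ l = N * f l - m l
  residual_le : ∀ l, |δ l| ≤ 1 / 2

namespace SeparatedAt

variable {N : ℕ} {f δ : Fin L → ℝ} {m : Fin L → ℤ} {Δ : ℝ}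

lemma cast_pos (h : SeparatedAt N f δ m Δ) : (0 : ℝ) < N :=
  lt_of_lt_of_le (div_pos (by norm_num) h.pos) h.large

lemma ne_zero (h : SeparatedAt N f δ m Δ) : N ≠ 0 := by
  rintro rfl
  simpa using h.cast_pos

lemma norm_dirichlet_le (h : SeparatedAt N f δ m Δ) {p l : Fin L} (hpl : l ≠ p) {u : ℝ}
    (hu : |u| ≤ 3) : ‖dirichlet N (((m l - m p : ℤ) : ℝ) + u)‖ ≤ 1 / (Δ * N) := by
  refine norm_dirichlet_le_of_shift h.pos h.large (h.sep l p hpl) ?_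
  have h1 := abs_le.1 (h.residual_le l)
  have h2 := abs_le.1 (h.residual_le p)
  have h3 := abs_le.1 hu
  have h4 := h.residual_eq l
  have h5 := h.residual_eq p
  push_cast
  rw [abs_le]
  constructor <;> nlinarith

lemma unitExp_ne_one (h : SeparatedAt N f δ m Δ) {p l : Fin L} (hpl : l ≠ p) {u : ℝ}
    (hu : |u| ≤ 3) : unitExp ((((m l - m p : ℤ) : ℝ) + u) / N) ≠ 1 := by
  intro heq
  have h1 := abs_le.1 (h.residual_le l)
  have h2 := abs_le.1 (h.residual_le p)
  have h3 := abs_le.1 hu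
  have h4 := h.residual_eq l
  have h5 := h.residual_eq p
  have hs := le_norm_unitExp_sub_one
    (separation_shift (u := ((m l - m p : ℤ) : ℝ) + u) h.pos h.large (h.sep l p hpl) (by
    push_cast
    rw [abs_le]
    constructor <;> nlinarith))
  rw [heq, sub_self, norm_zero] at hs
  linarith [h.pos]

lemma abs_sub_sub_half_le {a b s : ℝ} (ha : |a| ≤ 1 / 2) (hb : |b| ≤ 7 / 4) (hs : |s| ≤ 1) :
    |a - b - s / 2| ≤ 3 := by
  rw [abs_le] at *
  constructor <;> linarith

lemma abs_res_le (h : SeparatedAt N f δ m Δ) {ν : Fin L → ℝ} (hν : ∀ l, |δ l - ν l| ≤ 5 / 4)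
    (l : Fin L) : |ν l| ≤ 7 / 4 := by
  have h1 := abs_le.1 (h.residual_le l)
  have h2 := abs_le.1 (hν l)
  rw [abs_le]
  constructor <;> linarith

lemma norm_cross_le (h : SeparatedAt N f δ m Δ) {ν : Fin L → ℝ}
    (hν : ∀ l, |δ l - ν l| ≤ 5 / 4) {p l : Fin L} (hpl : l ≠ p) {s : ℝ} (hs : |s| ≤ 1) :
    ‖dirichlet N (((m l - m p : ℤ) : ℝ) + δ l - ν p - s / 2)‖ ≤ 1 / (Δ * N) := by
  have := h.norm_dirichlet_le hpl (abs_sub_sub_half_le (h.residual_le l) (h.abs_res_le hν p) hs)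
  convert this using 3
  ring

lemma norm_cross_residual_le (h : SeparatedAt N f δ m Δ) {ν : Fin L → ℝ}
    (hν : ∀ l, |δ l - ν l| ≤ 5 / 4) {p l : Fin L} (hpl : l ≠ p) {s : ℝ} (hs : |s| ≤ 1) :
    ‖dirichlet N (((m l - m p : ℤ) : ℝ) + ν l - ν p - s / 2)‖ ≤ 1 / (Δ * N) := by
  refine norm_dirichlet_le_of_shift h.pos h.large (h.sep l p hpl) ?_
  have h1 := abs_le.1 (hν l)
  have h2 := abs_le.1 (hν p)
  have h3 := abs_le.1 hs
  have h4 := h.residual_eq l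
  have h5 := h.residual_eq p
  push_cast
  rw [abs_le]
  constructor <;> nlinarith

/-- Each of the two kernels is `O(1/N)` by separation, so no cancellation between true and estimated
leakage is needed. Bounded amplitude estimates suffice, however inaccurate. -/
lemma norm_leakError_le (h : SeparatedAt N f δ m Δ) (A : Fin L → ℂ) {e : Estimates L}
    (hν : ∀ l, |δ l - e.residual l| ≤ 5 / 4) {K : ℝ} (hK : ∀ l, ‖e.amplitude l‖ ≤ K)
    (p : Fin L) {s : ℝ} (hs : |s| ≤ 1) :
    ‖leakError N A m δ e p s‖ ≤ (∑ l, (‖A l‖ + K)) / Δ / N := by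
  have hpos := h.cast_pos
  have hΔ := h.pos
  have hterm : ∀ l ∈ Finset.univ.erase p,
      ‖A l * dirichlet N (((m l - m p : ℤ) : ℝ) + δ l - e.residual p - s / 2) -
        e.amplitude l * dirichlet N (((m l - m p : ℤ) : ℝ) + e.residual l - e.residual p - s / 2)‖
        ≤ (‖A l‖ + K) * (1 / (Δ * N)) := by
    intro l hl
    have hpl := Finset.ne_of_mem_erase hl
    refine (norm_sub_le _ _).trans ?_
    rw [norm_mul, norm_mul, add_mul]
    have hK0 := (norm_nonneg _).trans (hK l)
    gcongr
    · exact h.norm_cross_le hν hpl hs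
    · exact hK l
    · exact h.norm_cross_residual_le hν hpl hs
  refine (norm_sum_le_of_le _ hterm).trans ?_
  refine (Finset.sum_le_sum_of_subset_of_nonneg (Finset.subset_univ _) fun l _ _ => ?_).trans_eq ?_
  · have hK0 := (norm_nonneg _).trans (hK l)
    positivity
  · rw [← Finset.sum_mul]
    field_simp

lemma unitExp_cross {s : ℝ} (hs : s = 1 ∨ s = -1) (k : ℤ) (a : ℝ) :
    unitExp ((k : ℝ) + a - s / 2) = -unitExp a := by
  rw [add_sub_assoc, unitExp_add, unitExp_intCast, one_mul]
  rcases hs with rfl | rfl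
  · exact unitExp_sub_half a
  · rw [← unitExp_add_half]
    congr 1
    ring

/-- Integer shifts do not affect `unitExp` and a half-bin shift changes its sign, so the numerator
is the `1 - unitExp` of the geometric sum. Separation supplies the nonzero denominator in the
application to `beta`. -/
lemma quotient_eq (hN : N ≠ 0) {s : ℝ} (hs : s = 1 ∨ s = -1) {k : ℤ} {a : ℝ}
    (hne : unitExp ((k + a - s / 2) / N) ≠ 1) :
    (1 + unitExp a) / (1 - unitExp ((k + a - s / 2) / N)) =
      N * dirichlet N (k + a - s / 2) := by
  have h1 := dirichlet_mul hN (k + a - s / 2)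
  rw [unitExp_cross hs] at h1
  have h2 : 1 - unitExp ((k + a - s / 2) / N) ≠ 0 := sub_ne_zero.2 hne.symm
  rw [div_eq_iff h2]
  linear_combination h1

lemma beta_eq (h : SeparatedAt N f δ m Δ) {ν : Fin L → ℝ} (hν : ∀ l, |δ l - ν l| ≤ 5 / 4)
    {p l : Fin L} (hpl : l ≠ p) {s : ℝ} (hs : s = 1 ∨ s = -1) :
    beta N m δ ν p l s =
      N * (dirichlet N (((m l - m p : ℤ) : ℝ) + δ l - ν p - s / 2) -
        dirichlet N (δ l - ν l) * dirichlet N (((m l - m p : ℤ) : ℝ) + ν l - ν p - s / 2)) := by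
  have hs' : |s| ≤ 1 := by rcases hs with rfl | rfl <;> norm_num
  have hexp (a : ℝ) : Complex.exp ((2 * Real.pi * Complex.I / N) * (a : ℂ)) = unitExp (a / N) := by
    rw [unitExp]
    congr 1
    push_cast
    ring
  have e1 : ((m l - m p : ℤ) : ℝ) + δ l - ν p - s / 2 =
      ((m l - m p : ℤ) : ℝ) + (δ l - ν p) - s / 2 := by ring
  have e2 : ((m l - m p : ℤ) : ℝ) + ν l - ν p - s / 2 =
      ((m l - m p : ℤ) : ℝ) + (ν l - ν p) - s / 2 := by ring
  have hne1 : unitExp ((((m l - m p : ℤ) : ℝ) + (δ l - ν p) - s / 2) / N) ≠ 1 := by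
    have := h.unitExp_ne_one hpl
      (abs_sub_sub_half_le (h.residual_le l) (h.abs_res_le hν p) hs')
    convert this using 3
    ring
  have hne2 : unitExp ((((m l - m p : ℤ) : ℝ) + (ν l - ν p) - s / 2) / N) ≠ 1 := by
    intro heq
    have h1 := abs_le.1 (hν l)
    have h2 := abs_le.1 (hν p)
    have h3 := abs_le.1 hs'
    have h4 := h.residual_eq l
    have h5 := h.residual_eq p
    have hs := le_norm_unitExp_sub_one
      (separation_shift (u := ((m l - m p : ℤ) : ℝ) + (ν l - ν p) - s / 2) h.pos h.large
        (h.sep l p hpl) (by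
      push_cast
      rw [abs_le]
      constructor <;> nlinarith))
    rw [heq, sub_self, norm_zero] at hs
    linarith [h.pos]
  rw [beta, hexp, hexp, ← unitExp, ← unitExp, e1, e2, quotient_eq h.ne_zero hs hne1,
    quotient_eq h.ne_zero hs hne2]
  ring

end SeparatedAt

/-! ### The mean error -/

lemma linError_eq (t : ℝ) (a b : ℂ) : linError t a b =
    (1 - 2 * t) * (Complex.exp (-(Real.pi * Complex.I * (t : ℂ))) * a).im +
      (1 + 2 * t) * (Complex.exp (-(Real.pi * Complex.I * (t : ℂ))) * b).im := by
  rw [linError, ← Complex.im_ofReal_mul, ← Complex.im_ofReal_mul, ← Complex.add_im]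
  congr 1
  ring

lemma linError_sub (t : ℝ) (a b c d : ℂ) :
    linError t a b - linError t c d = linError t (a - c) (b - d) := by
  rw [linError, linError, linError, ← Complex.sub_im]
  congr 1
  ring

lemma linError_real_mul (t r : ℝ) (a b : ℂ) :
    linError t (r * a) (r * b) = r * linError t a b := by
  rw [linError, linError, ← Complex.im_ofReal_mul]
  congr 1
  ring

lemma abs_linError_le {t ε : ℝ} (ht : |t| ≤ 5 / 4) {a b : ℂ} (ha : ‖a‖ ≤ ε) (hb : ‖b‖ ≤ ε) :
    |linError t a b| ≤ 7 * ε := by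
  refine (Complex.abs_im_le_norm _).trans ?_
  have h1 : ‖Complex.exp (-(Real.pi * Complex.I * (t : ℂ)))‖ = 1 := by
    have : (-(Real.pi * Complex.I * t) : ℂ) = ((-(Real.pi * t) : ℝ) : ℂ) * Complex.I := by
      push_cast; ring
    rw [this, Complex.norm_exp_ofReal_mul_I]
  have ht' := abs_le.1 ht
  have h2 : |1 - 2 * t| ≤ 7 / 2 := abs_le.2 ⟨by linarith, by linarith⟩
  have h3 : |1 + 2 * t| ≤ 7 / 2 := abs_le.2 ⟨by linarith, by linarith⟩
  rw [norm_mul, h1, one_mul]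
  refine (norm_add_le _ _).trans ?_
  rw [norm_mul, norm_mul, Complex.norm_real, Complex.norm_real, Real.norm_eq_abs, Real.norm_eq_abs]
  calc |1 - 2 * t| * ‖a‖ + |1 + 2 * t| * ‖b‖ ≤ 7 / 2 * ε + 7 / 2 * ε := by gcongr
    _ = 7 * ε := by ring

/-- The relative leakage that enters the mean error. -/
noncomputable def meanLeak (N : ℕ) (A : Fin L → ℂ) (m : Fin L → ℤ) (δ ν : Fin L → ℝ) (p : Fin L)
    (s : ℝ) : ℂ :=
  ∑ l ∈ Finset.univ.erase p, A l / A p *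
    (dirichlet N (((m l - m p : ℤ) : ℝ) + δ l - ν p - s / 2) -
      dirichlet N (δ l - ν l) * dirichlet N (((m l - m p : ℤ) : ℝ) + ν l - ν p - s / 2))

namespace SeparatedAt

variable {N : ℕ} {f δ : Fin L → ℝ} {m : Fin L → ℤ} {Δ : ℝ}

lemma leakageIm_eq (h : SeparatedAt N f δ m Δ) (A : Fin L → ℂ) {ν : Fin L → ℝ}
    (hν : ∀ l, |δ l - ν l| ≤ 5 / 4) (p : Fin L) {s : ℝ} (hs : s = 1 ∨ s = -1) :
    leakageIm N A m δ ν p s = N * (Complex.exp (-(Real.pi * Complex.I * ((δ p - ν p : ℝ) : ℂ))) *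
      meanLeak N A m δ ν p s).im := by
  rw [leakageIm, ← Complex.im_ofReal_mul, meanLeak]
  congr 1
  rw [mul_left_comm, Finset.mul_sum _ _ ((N : ℝ) : ℂ)]
  congr 1
  refine Finset.sum_congr rfl fun l hl => ?_
  rw [h.beta_eq hν (Finset.ne_of_mem_erase hl) hs]
  push_cast
  ring

/-- The mean error is the linearised interpolation applied to the leakage left when the amplitude
estimates are exactly `A_l D(δ_l - ν_l)`. The identity has no remainder. -/
lemma mul_meanError_eq (h : SeparatedAt N f δ m Δ) (A : Fin L → ℂ) {ν : Fin L → ℝ}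
    (hν : ∀ l, |δ l - ν l| ≤ 5 / 4) (p : Fin L) :
    N * meanError N A m δ ν p = Real.pi * gain (δ p - ν p) / 2 *
      linError (δ p - ν p) (meanLeak N A m δ ν p 1) (meanLeak N A m δ ν p (-1)) := by
  have hpos := h.cast_pos
  rw [meanError, h.leakageIm_eq A hν p (Or.inl rfl), h.leakageIm_eq A hν p (Or.inr rfl),
    linError_eq]
  field_simp

lemma norm_meanLeak_le (h : SeparatedAt N f δ m Δ) (A : Fin L → ℂ) {ν : Fin L → ℝ}
    (hν : ∀ l, |δ l - ν l| ≤ 5 / 4) (p : Fin L) {s : ℝ} (hs : |s| ≤ 1) :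
    ‖meanLeak N A m δ ν p s‖ ≤ (∑ l, ‖A l‖ * 2) / ‖A p‖ / Δ / N := by
  have hpos := h.cast_pos
  have hΔ := h.pos
  refine (norm_sum_le_of_le (n := fun l => ‖A l‖ * 2 / ‖A p‖ / Δ / N) _ fun l hl => ?_).trans ?_
  · have hpl := Finset.ne_of_mem_erase hl
    rw [norm_mul, norm_div]
    have h1 := h.norm_cross_le hν hpl hs
    have h2 := h.norm_cross_residual_le hν hpl hs
    have h3 := FreqEst.norm_dirichlet_le N (δ l - ν l)
    calc ‖A l‖ / ‖A p‖ * _ ≤ ‖A l‖ / ‖A p‖ * (1 / (Δ * N) + 1 * (1 / (Δ * N))) := by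
          gcongr
          refine (norm_sub_le _ _).trans ?_
          rw [norm_mul]
          gcongr
      _ = _ := by field_simp; ring
  · refine (Finset.sum_le_sum_of_subset_of_nonneg (Finset.subset_univ _)
      fun l _ _ => by positivity).trans_eq ?_
    simp only [Finset.sum_div]

end SeparatedAt

end FreqEst

namespace FreqEst

variable {L : ℕ}

/-! ### Expansion of one iteration -/

lemma exists_newResidual_expansion : ∃ C η : ℝ, 0 < C ∧ 0 < η ∧ ∃ N₀ : ℕ, ∀ N ≥ N₀,
    ∀ {L : ℕ} (A : Fin L → ℂ) {f δ : Fin L → ℝ} {m : Fin L → ℤ} (y : ℕ → ℂ) (e : Estimates L)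
      {p : Fin L} {ε : ℝ}, (∀ l, δ l = N * f l - m l) → A p ≠ 0 → |δ p - e.residual p| ≤ 5 / 4 →
      ‖relError N A m δ e y p 1‖ ≤ ε → ‖relError N A m δ e y p (-1)‖ ≤ ε → ε ≤ η →
    |newResidual N m (fun n => tones A f n + y n) e p - δ p -
      Real.pi * gain (δ p - e.residual p) / 2 * linError (δ p - e.residual p)
        (relError N A m δ e y p 1) (relError N A m δ e y p (-1))| ≤ C * (ε * (ε + 1 / N)) := by
  obtain ⟨C, η, hC, hη, N₀, h⟩ := exists_interpolate_expansion
  refine ⟨C, η, hC, hη, N₀ + 1, fun N hN L A f δ m y e p ε hδ hA ht h1 h2 hε => ?_⟩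
  have := h N (by omega) _ ε _ _ ht h1 h2 hε
  rw [newResidual_eq (by omega) A hδ y e hA]
  convert this using 2
  ring

lemma abs_pi_mul_gain_le {c t : ℝ} (hc : 0 < c) (h : c ≤ invGain t) (ht : |t| ≤ 5 / 4) :
    |Real.pi * gain t / 2| ≤ 1 / (2 * c) := by
  have hq : 0 < invGain t := by linarith
  have : Real.pi * gain t / 2 = -(1 / (2 * invGain t)) := by
    rw [gain_eq ht]
    have := Real.pi_ne_zero
    field_simp
  rw [this, abs_neg, abs_of_pos (by positivity)]
  gcongr

@[simp] lemma fourierCoeff_zero (N : ℕ) (k : ℝ) : fourierCoeff N (fun _ => 0) k = 0 := by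
  simp [fourierCoeff]

namespace SeparatedAt

variable {N : ℕ} {f δ : Fin L → ℝ} {m : Fin L → ℤ} {Δ : ℝ}

/-- The amplitude estimate of `l` deviates from `A_l D(δ_l - ν_l)` by the leakage of the other
components, which is `O(1/N)`. It enters the coefficient of `p` through a cross kernel, again
`O(1/N)`, so the effect is of second order. -/
lemma norm_relError_sub_meanLeak_le (h : SeparatedAt N f δ m Δ) (A : Fin L → ℂ) {ν : Fin L → ℝ}
    (hν : ∀ l, |δ l - ν l| ≤ 5 / 4) {b : Fin L → ℂ} {K : ℝ} (hb : ∀ l, ‖b l‖ ≤ K) {p : Fin L}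
    (hA : A p ≠ 0) {s : ℝ} (hs : |s| ≤ 1) :
    ‖relError N A m δ ⟨ν, newAmplitude N m (tones A f) ν b⟩ (fun _ => 0) p s -
      meanLeak N A m δ ν p s‖ ≤ L * ((∑ l, (‖A l‖ + K)) / Δ / Δ / ‖A p‖) / N ^ 2 := by
  have hpos := h.cast_pos
  have hΔ := h.pos
  have hAp : 0 < ‖A p‖ := norm_pos_iff.2 hA
  have hK : 0 ≤ K := (norm_nonneg _).trans (hb p)
  -- The shift in `leakError` is `0` because amplitudes are read off at the estimated frequency
  -- itself, not half a bin away.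
  have e1 : relError N A m δ ⟨ν, newAmplitude N m (tones A f) ν b⟩ (fun _ => 0) p s -
      meanLeak N A m δ ν p s = ∑ l ∈ Finset.univ.erase p, -(leakError N A m δ ⟨ν, b⟩ l 0 / A p *
        dirichlet N (((m l - m p : ℤ) : ℝ) + ν l - ν p - s / 2)) := by
    rw [relError, fourierCoeff_zero, add_zero, meanLeak, leakError, Finset.sum_div,
      ← Finset.sum_sub_distrib]
    refine Finset.sum_congr rfl fun l _ => ?_
    simp only [newAmplitude_eq h.ne_zero A h.residual_eq, leakError, zero_div, sub_zero]
    field_simp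
    ring
  rw [e1]
  refine (norm_sum_le_of_le (n := fun _ => (∑ l, (‖A l‖ + K)) / Δ / N / ‖A p‖ * (1 / (Δ * N))) _
    fun l hl => ?_).trans ?_
  · have hpl := Finset.ne_of_mem_erase hl
    rw [norm_neg, norm_mul, norm_div]
    have h1 := h.norm_leakError_le A (e := ⟨ν, b⟩) hν hb l (s := 0) (by simp)
    have h2 := h.norm_cross_residual_le hν hpl hs
    gcongr
  · refine (Finset.sum_le_sum_of_subset_of_nonneg (Finset.subset_univ _)
      fun l _ _ => by positivity).trans_eq ?_
    rw [Finset.sum_const, Finset.card_univ, Fintype.card_fin, nsmul_eq_mul]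
    field_simp

lemma freq_sub_eq (h : SeparatedAt N f δ m Δ) (ν : Fin L → ℝ) (p : Fin L) (μ : ℝ) :
    freq N m ν p - (f p + μ) = (ν p - δ p - N * μ) / N := by
  have hpos := h.cast_pos
  rw [freq, h.residual_eq]
  field_simp
  ring

end SeparatedAt

/-- Without noise, the error of the frequency estimate is `meanError` up to `O(N⁻³)`. -/
lemma exists_leakage_expansion (A : Fin L → ℂ) {p : Fin L} (hA : A p ≠ 0) {Δ : ℝ} (hΔ : 0 < Δ)
    {K : ℝ} (hK : 0 ≤ K) : ∃ C : ℝ, ∃ N₀ : ℕ, ∀ N ≥ N₀, ∀ {f δ : Fin L → ℝ} {m : Fin L → ℤ}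
      {ν : Fin L → ℝ} {b : Fin L → ℂ}, SeparatedAt N f δ m Δ → (∀ l, |δ l - ν l| ≤ 5 / 4) →
      (∀ l, ‖b l‖ ≤ K) →
      |freq N m (newResidual N m (tones A f) ⟨ν, newAmplitude N m (tones A f) ν b⟩) p -
        (f p + meanError N A m δ ν p)| ≤ C * (1 / (N : ℝ) ^ 3) := by
  obtain ⟨C, η, hC, hη, N₀, hexp⟩ := exists_newResidual_expansion
  obtain ⟨c, hc, hq⟩ := exists_le_invGain
  have hAp : 0 < ‖A p‖ := norm_pos_iff.2 hA
  set D := L * ((∑ l, (‖A l‖ + K)) / Δ / Δ / ‖A p‖) with hD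
  set B := (∑ l, ‖A l‖ * 2) / ‖A p‖ / Δ with hB
  have hD0 : 0 ≤ D := by positivity
  have hB0 : 0 ≤ B := by positivity
  refine ⟨C * ((B + D) * (B + D + 1)) + 1 / (2 * c) * (7 * D), N₀ + ⌈(B + D) / η⌉₊ + 1,
    fun N hN f δ m ν b h hν hb => ?_⟩
  have hpos := h.cast_pos
  have hN1 : (1 : ℝ) ≤ N := by exact_mod_cast (by omega : 1 ≤ N)
  have hrel (s : ℝ) (hs : |s| ≤ 1) :
      ‖relError N A m δ ⟨ν, newAmplitude N m (tones A f) ν b⟩ (fun _ => 0) p s‖ ≤ (B + D) / N := by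
    have h1 := h.norm_relError_sub_meanLeak_le A hν hb hA hs
    have h2 := h.norm_meanLeak_le A hν p hs
    have h3 : D / (N : ℝ) ^ 2 ≤ D / N := by
      gcongr
      nlinarith
    have h4 := norm_sub_norm_le
      (relError N A m δ ⟨ν, newAmplitude N m (tones A f) ν b⟩ (fun _ => 0) p s)
      (meanLeak N A m δ ν p s)
    rw [add_div]
    linarith
  -- The perturbation here is of size `(B + D)/N`, so the remainder `C ε (ε + 1/N)` is `O(N⁻²)`, the
  -- same order as the error from replacing `relError` by `meanLeak`.
  have hη' : (B + D) / N ≤ η := by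
    rw [div_le_iff₀ hpos, ← div_le_iff₀' hη]
    exact (Nat.le_ceil _).trans (by exact_mod_cast (by omega : ⌈(B + D) / η⌉₊ ≤ N))
  have h1 := hexp N (by omega) A (fun _ => 0) ⟨ν, newAmplitude N m (tones A f) ν b⟩
    h.residual_eq hA (hν p) (hrel 1 (by simp)) (hrel (-1) (by simp)) hη'
  simp only [add_zero] at h1
  have h2 := h.mul_meanError_eq A hν p
  have h3 := abs_linError_le (hν p)
    (h.norm_relError_sub_meanLeak_le A hν hb hA (s := 1) (by simp))
    (h.norm_relError_sub_meanLeak_le A hν hb hA (s := -1) (by simp))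
  rw [← hD, ← linError_sub] at h3
  have h4 := abs_pi_mul_gain_le hc (hq _ (hν p)) (hν p)
  rw [h.freq_sub_eq, h2, abs_div, abs_of_pos hpos, div_le_iff₀ hpos]
  have h5 : newResidual N m (fun n => tones A f n)
      ⟨ν, newAmplitude N m (tones A f) ν b⟩ p = newResidual N m (tones A f)
      ⟨ν, newAmplitude N m (tones A f) ν b⟩ p := rfl
  rw [h5] at h1
  have h6 := abs_add_le _ _ |>.trans (add_le_add h1
    ((abs_mul _ _).trans_le (mul_le_mul h4 h3 (abs_nonneg _) (by positivity))))
  refine le_trans (le_of_eq ?_) (h6.trans (le_of_eq ?_))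
  · congr 1
    ring
  · field_simp

/-! ### The size of the noise -/

/-- A bound for the Fourier coefficient of the noise near `k`, in units of `1 / √N`. -/
noncomputable def noiseSize (N : ℕ) (y : ℕ → ℂ) (k : ℝ) : ℝ :=
  (‖∑ j ∈ Finset.range N, y j * unitExp (-(k * j / N))‖ + (1 / N) * ∑ n ∈ Finset.range N,
    ‖∑ j ∈ Finset.range (n + 1), y j * unitExp (-(k * j / N))‖) / Real.sqrt N

lemma sum_mul_by_parts (x c : ℕ → ℂ) (N : ℕ) :
    ∑ n ∈ Finset.range N, x n * c n = c N * ∑ n ∈ Finset.range N, x n -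
      ∑ n ∈ Finset.range N, (c (n + 1) - c n) * ∑ j ∈ Finset.range (n + 1), x j := by
  induction N with
  | zero => simp
  | succ N ih =>
    rw [Finset.sum_range_succ (fun n => x n * c n), ih, Finset.sum_range_succ
      (fun n => (c (n + 1) - c n) * ∑ j ∈ Finset.range (n + 1), x j), Finset.sum_range_succ x]
    ring

lemma noiseSize_nonneg (N : ℕ) (y : ℕ → ℂ) (k : ℝ) : 0 ≤ noiseSize N y k := by
  unfold noiseSize
  positivity

lemma norm_fourierCoeff_le {N : ℕ} (hN : N ≠ 0) (y : ℕ → ℂ) (k : ℝ) :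
    ‖fourierCoeff N y k‖ ≤ noiseSize N y k / Real.sqrt N := by
  have hN' : (0 : ℝ) < N := by positivity
  rw [fourierCoeff_eq, noiseSize, div_div, Real.mul_self_sqrt hN'.le, norm_mul]
  simp only [norm_div, norm_one, Complex.norm_natCast]
  rw [one_div, inv_mul_eq_div]
  gcongr
  simp only [le_add_iff_nonneg_right]
  positivity

/-- Moving the location multiplies the summands by a slowly varying phase, with increments at most
`2π|k' - k|/N`. Summation by parts bounds the change by partial sums at the fixed location `k` only.
The bound holds for every `k'`, hence also for locations that depend on the noise. -/
lemma norm_fourierCoeff_sub_le {N : ℕ} (hN : N ≠ 0) (y : ℕ → ℂ) (k k' : ℝ) :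
    ‖fourierCoeff N y k' - fourierCoeff N y k‖ ≤
      2 * Real.pi * |k' - k| * (noiseSize N y k / Real.sqrt N) := by
  have hN' : (0 : ℝ) < N := by positivity
  set c : ℕ → ℂ := fun n => unitExp (-((k' - k) * n / N)) - 1 with hc
  have e1 : fourierCoeff N y k' - fourierCoeff N y k =
      (1 / N) * ∑ n ∈ Finset.range N, (y n * unitExp (-(k * n / N))) * c n := by
    rw [fourierCoeff_eq, fourierCoeff_eq, ← mul_sub, ← Finset.sum_sub_distrib]
    congr 1
    refine Finset.sum_congr rfl fun n _ => ?_
    have : unitExp (-(k' * n / N)) = unitExp (-(k * n / N)) * unitExp (-((k' - k) * n / N)) := by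
      rw [← unitExp_add]
      congr 1
      ring
    rw [this, hc]
    ring
  have hcN : ‖c N‖ ≤ 2 * Real.pi * |k' - k| := by
    refine (norm_unitExp_sub_one_le _).trans_eq ?_
    rw [abs_neg, mul_div_cancel_right₀ _ hN'.ne']
  have hcn (n : ℕ) : ‖c (n + 1) - c n‖ ≤ 2 * Real.pi * |k' - k| * (1 / N) := by
    have : c (n + 1) - c n = unitExp (-((k' - k) * ((n + 1 : ℕ) : ℝ) / N)) -
        unitExp (-((k' - k) * n / N)) := by rw [hc]; ring
    rw [this]
    refine (norm_unitExp_sub_le _ _).trans_eq ?_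
    have : -((k' - k) * ((n + 1 : ℕ) : ℝ) / N) - -((k' - k) * n / N) = -((k' - k) / N) := by
      push_cast; ring
    rw [this, abs_neg, abs_div, abs_of_pos hN']
    ring
  rw [e1, sum_mul_by_parts, norm_mul, noiseSize, div_div, Real.mul_self_sqrt hN'.le]
  simp only [norm_div, norm_one, Complex.norm_natCast]
  calc (1 / N : ℝ) * _ ≤ (1 / N : ℝ) * (2 * Real.pi * |k' - k| *
        ‖∑ j ∈ Finset.range N, y j * unitExp (-(k * j / N))‖ +
        ∑ n ∈ Finset.range N, 2 * Real.pi * |k' - k| * (1 / N) *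
          ‖∑ j ∈ Finset.range (n + 1), y j * unitExp (-(k * j / N))‖) := by
        gcongr
        refine (norm_sub_le _ _).trans ?_
        rw [norm_mul]
        gcongr
        refine norm_sum_le_of_le _ fun n _ => ?_
        rw [norm_mul]
        gcongr
        exact hcn n
    _ = _ := by
        rw [← Finset.mul_sum]
        ring

end FreqEst

namespace FreqEst

variable {L : ℕ}

/-! ### The linear statistic -/

/-- The weight of the normalised Fourier coefficient of the noise at distance `s / 2`. -/
noncomputable def weight (a : ℂ) (σ t s : ℝ) : ℂ :=
  Complex.I * (‖a‖ / (σ * a)) *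
    (Complex.exp (-(Real.pi * Complex.I * (t : ℂ))) * ((1 - 2 * s * t) / √(1 + 4 * t ^ 2) : ℝ))

/-- The standardised linear statistic of a pair of normalised Fourier coefficients. -/
noncomputable def linStat (a : ℂ) (σ t : ℝ) (gp gm : ℂ) : ℝ :=
  (weight a σ t 1 * gp + weight a σ t (-1) * gm).re

/-- The factor `I` in `weight` turns the imaginary part in `linError` into a real part. The
resulting minus sign matches that of `gain`. -/
lemma linStat_eq (a : ℂ) (σ t : ℝ) (gp gm : ℂ) : linStat a σ t gp gm =
    -(‖a‖ / (σ * √(1 + 4 * t ^ 2)) * linError t (gp / a) (gm / a)) := by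
  have : weight a σ t 1 * gp + weight a σ t (-1) * gm =
      ((‖a‖ / (σ * √(1 + 4 * t ^ 2)) : ℝ) : ℂ) *
      (Complex.exp (-(Real.pi * Complex.I * (t : ℂ))) *
        ((1 - 2 * t : ℝ) * (gp / a) + (1 + 2 * t : ℝ) * (gm / a)) * Complex.I) := by
    simp only [weight]
    push_cast
    simp only [div_eq_mul_inv, mul_inv]
    ring
  rw [linStat, this, Complex.re_ofReal_mul, Complex.mul_I_re, linError]
  ring

lemma norm_weight {a : ℂ} (ha : a ≠ 0) {σ : ℝ} (hσ : 0 < σ) (t s : ℝ) :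
    ‖weight a σ t s‖ = |1 - 2 * s * t| / √(1 + 4 * t ^ 2) / σ := by
  have h1 : ‖Complex.exp (-(Real.pi * Complex.I * (t : ℂ)))‖ = 1 := by
    have : (-(Real.pi * Complex.I * t) : ℂ) = ((-(Real.pi * t) : ℝ) : ℂ) * Complex.I := by
      push_cast; ring
    rw [this, Complex.norm_exp_ofReal_mul_I]
  have ha' : 0 < ‖a‖ := norm_pos_iff.2 ha
  simp only [weight, norm_mul, h1, Complex.norm_I, norm_div, Complex.norm_real,
    Real.norm_eq_abs, abs_norm, abs_of_pos hσ, abs_of_nonneg (Real.sqrt_nonneg _)]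
  field_simp

/-- Here `(1 - 2t)² + (1 + 2t)² = 2 (1 + 4t²)` removes all dependence on `t`. The value is the one
for unit variance, since the real part of a normalised noise coefficient has variance `σ²/2`. -/
lemma norm_weight_sq_add {a : ℂ} (ha : a ≠ 0) {σ : ℝ} (hσ : 0 < σ) (t : ℝ) :
    ‖weight a σ t 1‖ ^ 2 + ‖weight a σ t (-1)‖ ^ 2 = 2 / σ ^ 2 := by
  have h : (0 : ℝ) < 1 + 4 * t ^ 2 := by positivity
  rw [norm_weight ha hσ, norm_weight ha hσ]
  simp only [div_pow, sq_abs, Real.sq_sqrt h.le]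
  field_simp
  ring

lemma norm_weight_le {a : ℂ} (ha : a ≠ 0) {σ : ℝ} (hσ : 0 < σ) (t : ℝ) {s : ℝ}
    (hs : s = 1 ∨ s = -1) : ‖weight a σ t s‖ ≤ 2 / σ := by
  have h := norm_weight_sq_add ha hσ t
  refine abs_le_of_sq_le_sq' ?_ (by positivity) |>.2
  have : 2 / σ ^ 2 ≤ (2 / σ) ^ 2 := by
    rw [div_pow]
    gcongr
    norm_num
  rcases hs with rfl | rfl <;>
    nlinarith [sq_nonneg ‖weight a σ t 1‖, sq_nonneg ‖weight a σ t (-1)‖]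

lemma continuous_weight (a : ℂ) (σ s : ℝ) : Continuous fun t => weight a σ t s := by
  have h (t : ℝ) : √(1 + 4 * t ^ 2) ≠ 0 := by positivity
  unfold weight
  refine Continuous.mul (by fun_prop) (Continuous.mul (by fun_prop) ?_)
  exact Complex.continuous_ofReal.comp (Continuous.div (by fun_prop) (by fun_prop) h)

lemma exists_weight_modulus (a : ℂ) (σ s : ℝ) {ε : ℝ} (hε : 0 < ε) : ∃ η : ℝ, 0 < η ∧
    ∀ t t' : ℝ, |t| ≤ 5 / 4 → |t'| ≤ 5 / 4 → |t - t'| ≤ η →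
      ‖weight a σ t s - weight a σ t' s‖ ≤ ε := by
  have hu := (isCompact_Icc (a := -(5 / 4 : ℝ)) (b := 5 / 4)).uniformContinuousOn_of_continuous
    (continuous_weight a σ s).continuousOn
  obtain ⟨η, hη, h⟩ := Metric.uniformContinuousOn_iff.1 hu ε hε
  refine ⟨η / 2, by positivity, fun t t' ht ht' htt => ?_⟩
  have := h t (abs_le.1 ht) t' (abs_le.1 ht') (by rw [Real.dist_eq]; linarith)
  rw [dist_eq_norm] at this
  exact this.le

lemma exists_linStat_modulus {a : ℂ} (ha : a ≠ 0) {σ : ℝ} (hσ : 0 < σ) {K ε : ℝ} (hK : 0 ≤ K)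
    (hε : 0 < ε) : ∃ η : ℝ, 0 < η ∧ ∀ (t t' : ℝ) (gp gm gp' gm' : ℂ), |t| ≤ 5 / 4 →
      |t'| ≤ 5 / 4 → |t - t'| ≤ η → ‖gp'‖ ≤ K → ‖gm'‖ ≤ K → ‖gp - gp'‖ ≤ 2 * Real.pi * η * K →
      ‖gm - gm'‖ ≤ 2 * Real.pi * η * K → |linStat a σ t gp gm - linStat a σ t' gp' gm'| ≤ ε := by
  obtain ⟨η₁, h1, H1⟩ := exists_weight_modulus a σ 1 (ε := ε / (4 * (K + 1))) (by positivity)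
  obtain ⟨η₂, h2, H2⟩ := exists_weight_modulus a σ (-1) (ε := ε / (4 * (K + 1))) (by positivity)
  have hπ := Real.pi_pos
  -- The last entry makes the displacement of the coefficients, `2πηK`, times the weight bound `2/σ`
  -- at most `ε/4`.
  set η := min (min η₁ η₂) (ε * σ / (16 * Real.pi * (K + 1))) with hη
  have hη0 : 0 < η := by positivity
  refine ⟨η, hη0, fun t t' gp gm gp' gm' ht ht' htt hp hm hpp hmm => ?_⟩
  have hw1 := H1 t t' ht ht' (htt.trans ((min_le_left _ _).trans (min_le_left _ _)))
  have hw2 := H2 t t' ht ht' (htt.trans ((min_le_left _ _).trans (min_le_right _ _)))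
  have hηle : η ≤ ε * σ / (16 * Real.pi * (K + 1)) := min_le_right _ _
  have hg : 2 / σ * (2 * Real.pi * η * K) ≤ ε / 4 := by
    calc 2 / σ * (2 * Real.pi * η * K) ≤
        2 / σ * (2 * Real.pi * (ε * σ / (16 * Real.pi * (K + 1))) * (K + 1)) := by
          gcongr
          linarith
      _ = ε / 4 := by field_simp; norm_num
  have hk : ε / (4 * (K + 1)) * K ≤ ε / 4 := by
    calc ε / (4 * (K + 1)) * K ≤ ε / (4 * (K + 1)) * (K + 1) := by gcongr; linarith
      _ = ε / 4 := by field_simp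
  rw [linStat, linStat, ← Complex.sub_re]
  refine (Complex.abs_re_le_norm _).trans ?_
  have e : weight a σ t 1 * gp + weight a σ t (-1) * gm -
      (weight a σ t' 1 * gp' + weight a σ t' (-1) * gm') =
      (weight a σ t 1 * (gp - gp') + (weight a σ t 1 - weight a σ t' 1) * gp') +
      (weight a σ t (-1) * (gm - gm') + (weight a σ t (-1) - weight a σ t' (-1)) * gm') := by ring
  have hb (w w' g g' : ℂ) (hw : ‖w‖ ≤ 2 / σ) (hww : ‖w - w'‖ ≤ ε / (4 * (K + 1)))
      (hg' : ‖g'‖ ≤ K) (hgg : ‖g - g'‖ ≤ 2 * Real.pi * η * K) :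
      ‖w * (g - g') + (w - w') * g'‖ ≤ ε / 2 := by
    refine (norm_add_le _ _).trans ?_
    rw [norm_mul, norm_mul]
    have h1 : ‖w‖ * ‖g - g'‖ ≤ 2 / σ * (2 * Real.pi * η * K) := by gcongr
    have h2 : ‖w - w'‖ * ‖g'‖ ≤ ε / (4 * (K + 1)) * K := by gcongr
    linarith
  rw [e]
  refine (norm_add_le _ _).trans ?_
  have := hb _ _ _ _ (norm_weight_le ha hσ t (Or.inl rfl)) hw1 hp hpp
  have := hb _ _ _ _ (norm_weight_le ha hσ t (Or.inr rfl)) hw2 hm hmm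
  linarith

/-! ### Standardisation -/

lemma sqrt_varError {N : ℕ} (hN : N ≠ 0) (A : Fin L → ℂ) {σ : ℝ} (hσ : 0 < σ)
    (δ ν : Fin L → ℝ) {p : Fin L} (hA : A p ≠ 0) (ht : |δ p - ν p| ≤ 5 / 4) :
    √(varError N A σ δ ν p) = σ * √(1 + 4 * (δ p - ν p) ^ 2) /
      (2 * ‖A p‖ * invGain (δ p - ν p) * N * √N) := by
  have hN' : (0 : ℝ) < N := by positivity
  have hAp : 0 < ‖A p‖ := norm_pos_iff.2 hA
  have hq := invGain_pos ht
  have hπ := Real.pi_pos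
  rw [varError, gain_eq ht]
  set t := δ p - ν p
  rw [Real.sqrt_eq_iff_mul_self_eq_of_pos (by positivity), div_mul_div_comm]
  have e1 : σ * √(1 + 4 * t ^ 2) * (σ * √(1 + 4 * t ^ 2)) = σ ^ 2 * (1 + 4 * t ^ 2) := by
    rw [mul_mul_mul_comm, Real.mul_self_sqrt (by positivity)]
    ring
  have e2 : 2 * ‖A p‖ * invGain t * N * √N * (2 * ‖A p‖ * invGain t * N * √N) =
      4 * ‖A p‖ ^ 2 * invGain t ^ 2 * N ^ 3 := by
    rw [mul_mul_mul_comm, Real.mul_self_sqrt hN'.le]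
    ring
  rw [e1, e2]
  field_simp

/-- The standardised error of a frequency estimate. -/
noncomputable def stdError (N : ℕ) (A : Fin L → ℂ) (σ : ℝ) (f : Fin L → ℝ) (m : Fin L → ℤ)
    (δ ν ν' : Fin L → ℝ) (p : Fin L) : ℝ :=
  (freq N m ν' p - (f p + meanError N A m δ ν p)) / √(varError N A σ δ ν p)

lemma SeparatedAt.stdError_eq {N : ℕ} {f δ : Fin L → ℝ} {m : Fin L → ℤ} {Δ : ℝ}
    (h : SeparatedAt N f δ m Δ) (A : Fin L → ℂ) {σ : ℝ} (hσ : 0 < σ) (ν ν' : Fin L → ℝ)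
    {p : Fin L} (hA : A p ≠ 0) (ht : |δ p - ν p| ≤ 5 / 4) :
    stdError N A σ f m δ ν ν' p = (ν' p - δ p - N * meanError N A m δ ν p) *
      (2 * ‖A p‖ * invGain (δ p - ν p) * √N / (σ * √(1 + 4 * (δ p - ν p) ^ 2))) := by
  have hpos := h.cast_pos
  rw [stdError, h.freq_sub_eq, sqrt_varError h.ne_zero A hσ δ ν hA ht]
  field_simp

/-! ### One iteration with noise -/

/-- The vector of linear statistics at the residuals `ν`. -/
noncomputable def noiseStat (N : ℕ) (A : Fin L → ℂ) (σ : ℝ) (m : Fin L → ℤ) (δ ν : Fin L → ℝ)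
    (y : ℕ → ℂ) (p : Fin L) : ℝ :=
  linStat (A p) σ (δ p - ν p) (√N * fourierCoeff N y (m p + ν p + 1 / 2))
    (√N * fourierCoeff N y (m p + ν p + -1 / 2))

/-- The size of the noise at all locations used in one iteration. -/
noncomputable def totalNoise (N : ℕ) (m : Fin L → ℤ) (ν : Fin L → ℝ) (y : ℕ → ℂ) : ℝ :=
  ∑ p, (noiseSize N y (m p + ν p + 1 / 2) + noiseSize N y (m p + ν p + -1 / 2))

lemma noiseSize_le_totalNoise (N : ℕ) (m : Fin L → ℤ) (ν : Fin L → ℝ) (y : ℕ → ℂ) (p : Fin L)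
    {s : ℝ} (hs : s = 1 ∨ s = -1) : noiseSize N y (m p + ν p + s / 2) ≤ totalNoise N m ν y := by
  have h := Finset.single_le_sum (f := fun p => noiseSize N y (m p + ν p + 1 / 2) +
    noiseSize N y (m p + ν p + -1 / 2)) (fun p _ => add_nonneg (noiseSize_nonneg _ _ _)
      (noiseSize_nonneg _ _ _)) (Finset.mem_univ p)
  refine le_trans ?_ h
  rcases hs with rfl | rfl
  · simp [noiseSize_nonneg]
  · simp [noiseSize_nonneg]

lemma totalNoise_nonneg (N : ℕ) (m : Fin L → ℤ) (ν : Fin L → ℝ) (y : ℕ → ℂ) :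
    0 ≤ totalNoise N m ν y :=
  Finset.sum_nonneg fun _ _ => add_nonneg (noiseSize_nonneg _ _ _) (noiseSize_nonneg _ _ _)

lemma norm_fourierCoeff_le_near {N : ℕ} (hN : N ≠ 0) (y : ℕ → ℂ) {k k' K d : ℝ}
    (hK : noiseSize N y k ≤ K) (hd : |k' - k| ≤ d) :
    ‖fourierCoeff N y k'‖ ≤ (1 + 2 * Real.pi * d) * K / √N := by
  have hN' : (0 : ℝ) < √N := by positivity
  have h1 := norm_fourierCoeff_le hN y k
  have h2 := norm_fourierCoeff_sub_le hN y k k'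
  have h3 := norm_le_norm_add_norm_sub' (fourierCoeff N y k') (fourierCoeff N y k)
  have hK' : noiseSize N y k / √N ≤ K / √N := by gcongr
  have h4 : 2 * Real.pi * |k' - k| * (noiseSize N y k / √N) ≤ 2 * Real.pi * d * (K / √N) := by
    have := noiseSize_nonneg N y k
    have := Real.pi_pos
    have hd0 : 0 ≤ d := (abs_nonneg _).trans hd
    gcongr
  have e : (1 + 2 * Real.pi * d) * K / √N = K / √N + 2 * Real.pi * d * (K / √N) := by ring
  rw [e]
  linarith

/-- Amplitude estimates stay bounded. -/
lemma norm_newAmplitude_le {N : ℕ} (hN : N ≠ 0) (A : Fin L → ℂ) {f : Fin L → ℝ} {m : Fin L → ℤ}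
    {y : ℕ → ℂ} {ν ref : Fin L → ℝ} {b : Fin L → ℂ} {K : ℝ} (hb : ∀ l, ‖b l‖ ≤ K)
    (hy : totalNoise N m ref y ≤ K) {p : Fin L} (hν : |ν p - ref p| ≤ 5 / 2) :
    ‖newAmplitude N m (fun n => tones A f n + y n) ν b p‖ ≤
      ∑ l, ‖A l‖ + (1 + 2 * Real.pi * 3) * K + L * K := by
  have hK : 0 ≤ K := (totalNoise_nonneg _ _ _ _).trans hy
  have hN' : 1 ≤ √(N : ℝ) := Real.one_le_sqrt.2 (by exact_mod_cast Nat.one_le_iff_ne_zero.2 hN)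
  rw [newAmplitude, fourierCoeff_add, fourierCoeff_tones hN]
  have h1 : ‖∑ l, A l * dirichlet N (N * f l - (m p + ν p))‖ ≤ ∑ l, ‖A l‖ := by
    refine norm_sum_le_of_le _ fun l _ => ?_
    rw [norm_mul]
    exact mul_le_of_le_one_right (norm_nonneg _) (norm_dirichlet_le _ _)
  -- The noise is controlled half a bin away from the location used here, which accounts for `5/2 +
  -- 1/2 = 3`.
  have h2 : ‖fourierCoeff N y (m p + ν p)‖ ≤ (1 + 2 * Real.pi * 3) * K := by
    refine (norm_fourierCoeff_le_near hN y
      ((noiseSize_le_totalNoise N m ref y p (Or.inl rfl)).trans hy) (d := 3) ?_).trans ?_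
    · rw [abs_le] at *
      constructor <;> linarith
    · have := Real.pi_pos
      exact div_le_self (by positivity) hN'
  have h3 : ‖∑ l ∈ Finset.univ.erase p, b l * dirichlet N (((m l - m p : ℤ) : ℝ) + ν l - ν p)‖ ≤
      L * K := by
    refine (norm_sum_le_of_le (n := fun _ => K) _ fun l _ => ?_).trans ?_
    · rw [norm_mul]
      exact (mul_le_of_le_one_right (norm_nonneg _) (norm_dirichlet_le _ _)).trans (hb l)
    · refine (Finset.sum_le_sum_of_subset_of_nonneg (Finset.subset_univ _)
        fun l _ _ => hK).trans_eq ?_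
      simp
  refine (norm_sub_le _ _).trans ?_
  have := norm_add_le (∑ l, A l * dirichlet N (N * f l - (m p + ν p)))
    (fourierCoeff N y (m p + ν p))
  linarith

lemma exists_div_sqrt_le (C : ℝ) {ε : ℝ} (hε : 0 < ε) : ∃ N₀ : ℕ, ∀ N ≥ N₀, C / √(N : ℝ) ≤ ε := by
  have h : Tendsto (fun N : ℕ => C / √(N : ℝ)) atTop (𝓝 0) :=
    tendsto_const_nhds.div_atTop
      (Real.tendsto_sqrt_atTop.comp tendsto_natCast_atTop_atTop)
  obtain ⟨N₀, h0⟩ := eventually_atTop.1 (h.eventually (ge_mem_nhds hε))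
  exact ⟨N₀, h0⟩

/-- Close to the reference residuals, the residual estimates are consistent, and the
standardised errors are close to the linear statistics at the reference residuals. -/
lemma exists_stdError_approx (A : Fin L → ℂ) {p : Fin L} (hA : A p ≠ 0) {σ Δ K ε : ℝ}
    (hσ : 0 < σ) (hΔ : 0 < Δ) (hK : 0 ≤ K) (hε : 0 < ε) : ∃ η : ℝ, 0 < η ∧ ∃ N₀ : ℕ, ∀ N ≥ N₀,
    ∀ {f δ ref : Fin L → ℝ} {m : Fin L → ℤ} {e : Estimates L} {y : ℕ → ℂ},
      SeparatedAt N f δ m Δ → (∀ l, |δ l - ref l| ≤ 1) → (∀ l, |e.residual l - ref l| ≤ η) →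
      (∀ l, ‖e.amplitude l‖ ≤ K) → totalNoise N m ref y ≤ K →
      |newResidual N m (fun n => tones A f n + y n) e p - δ p| ≤ ε ∧
      |stdError N A σ f m δ e.residual (newResidual N m (fun n => tones A f n + y n) e) p -
        noiseStat N A σ m δ ref y p| ≤ ε := by
  obtain ⟨C, η₀, hC, hη₀, N₁, hexp⟩ := exists_newResidual_expansion
  obtain ⟨c, hc, hq⟩ := exists_le_invGain
  obtain ⟨η₁, hη₁, hmod⟩ := exists_linStat_modulus hA hσ hK (half_pos hε)
  have hAp : 0 < ‖A p‖ := norm_pos_iff.2 hA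
  have hπ := Real.pi_pos
  set M := (∑ l, (‖A l‖ + K)) / Δ with hM
  set M' := (∑ l, ‖A l‖ * 2) / ‖A p‖ / Δ with hM'
  have hM0 : 0 ≤ M := by positivity
  have hM0' : 0 ≤ M' := by positivity
  set E := (M + (1 + 2 * Real.pi * 1) * K) / ‖A p‖ with hE
  have hE0 : 0 ≤ E := by positivity
  -- `G / N` collects the nonlinear remainder, the leakage and the mean error of a residual. The
  -- standardising factor is at most a constant times `√N`, so their joint contribution is
  -- `O(1/√N)`.
  set G := C * (E * (E + 1)) + 1 / (2 * c) * (7 * (M / ‖A p‖)) + 1 / (2 * c) * (7 * M') with hG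
  have hG0 : 0 ≤ G := by positivity
  obtain ⟨N₂, hN₂⟩ := exists_div_sqrt_le E hη₀
  obtain ⟨N₃, hN₃⟩ := exists_div_sqrt_le (C * (E * (E + 1)) + 1 / (2 * c) * (7 * E)) hε
  obtain ⟨N₄, hN₄⟩ := exists_div_sqrt_le (G * (4 * ‖A p‖ / σ)) (half_pos hε)
  -- The `1/4` keeps the residual differences within `1 + 1/4 = 5/4`, the range of the uniform
  -- estimates.
  refine ⟨min η₁ (1 / 4), by positivity, N₁ + N₂ + N₃ + N₄,
    fun N hN f δ ref m e y h href hres hamp hy => ?_⟩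
  have hpos := h.cast_pos
  have hN1 : (1 : ℝ) ≤ N := by exact_mod_cast Nat.one_le_iff_ne_zero.2 h.ne_zero
  have hs1 : 1 ≤ √(N : ℝ) := Real.one_le_sqrt.2 hN1
  have hs0 : 0 < √(N : ℝ) := by linarith
  have hss : √(N : ℝ) * √(N : ℝ) = N := Real.mul_self_sqrt hpos.le
  have hsN : √(N : ℝ) ≤ N := by nlinarith
  have hν (l : Fin L) : |δ l - e.residual l| ≤ 5 / 4 := by
    have h1 := abs_le.1 (href l)
    have h2 := abs_le.1 ((hres l).trans (min_le_right _ _))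
    rw [abs_le]
    constructor <;> linarith
  set t := δ p - e.residual p with ht
  have htp : |t| ≤ 5 / 4 := hν p
  have hloc (s : ℝ) : |((m p : ℝ) + e.residual p + s / 2) - (m p + ref p + s / 2)| ≤
      min η₁ (1 / 4) := by
    convert hres p using 2
    ring
  have hFC (s : ℝ) (hs : s = 1 ∨ s = -1) :
      ‖fourierCoeff N y (m p + e.residual p + s / 2)‖ ≤ (1 + 2 * Real.pi * 1) * K / √N :=
    norm_fourierCoeff_le_near h.ne_zero y ((noiseSize_le_totalNoise N m ref y p hs).trans hy)
      ((hloc s).trans ((min_le_right _ _).trans (by norm_num)))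
  have habs {s : ℝ} (hs : s = 1 ∨ s = -1) : |s| ≤ 1 := by rcases hs with rfl | rfl <;> simp
  have hleak (s : ℝ) (hs : s = 1 ∨ s = -1) : ‖leakError N A m δ e p s‖ ≤ M / N :=
    h.norm_leakError_le A hν hamp p (habs hs)
  have hrel (s : ℝ) (hs : s = 1 ∨ s = -1) : ‖relError N A m δ e y p s‖ ≤ E / √N := by
    rw [relError, norm_div, hE, div_right_comm, add_div]
    gcongr
    refine (norm_add_le _ _).trans (add_le_add ((hleak s hs).trans ?_) (hFC s hs))
    gcongr
  have hmain := hexp N (by omega) A y e h.residual_eq hA htp (hrel 1 (Or.inl rfl))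
    (hrel (-1) (Or.inr rfl)) (hN₂ N (by omega))
  have hrem : C * (E / √N * (E / √N + 1 / N)) ≤ C * (E * (E + 1)) / N := by
    have h1 : 1 / (N : ℝ) ≤ 1 / √N := by gcongr
    have h2 : E / √(N : ℝ) + 1 / N ≤ (E + 1) / √N := by rw [add_div]; gcongr
    calc C * (E / √N * (E / √N + 1 / N)) ≤ C * (E / √N * ((E + 1) / √N)) := by gcongr
      _ = C * (E * (E + 1)) / (√N * √N) := by field_simp
      _ = _ := by rw [hss]
  have hgain := abs_pi_mul_gain_le hc (hq t htp) htp
  set R := newResidual N m (fun n => tones A f n + y n) e with hR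
  refine ⟨?_, ?_⟩
  · have h1 := abs_linError_le htp (hrel 1 (Or.inl rfl)) (hrel (-1) (Or.inr rfl))
    have h2 := (abs_mul (Real.pi * gain t / 2) _).trans_le
      (mul_le_mul hgain h1 (abs_nonneg _) (by positivity))
    have h3 := abs_add_le _ _ |>.trans (add_le_add (hmain.trans hrem) h2)
    rw [sub_add_cancel] at h3
    refine h3.trans (le_trans ?_ (hN₃ N (by omega)))
    rw [add_div]
    have e1 : 1 / (2 * c) * (7 * (E / √N)) = 1 / (2 * c) * (7 * E) / √N := by ring
    rw [e1]
    gcongr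
  · set T := √(1 + 4 * t ^ 2) with hT
    have hT1 : 1 ≤ T := Real.one_le_sqrt.2 (by nlinarith [sq_nonneg t])
    set g := 2 * ‖A p‖ * invGain t * √N / (σ * T) with hg
    have hq0 : 0 < invGain t := invGain_pos htp
    have hg0 : 0 < g := by positivity
    have hgle : g ≤ 4 * ‖A p‖ / σ * √N := by
      have := (abs_le.1 (abs_invGain_le t)).2
      calc g ≤ 2 * ‖A p‖ * 2 * √N / (σ * 1) := by rw [hg]; gcongr
        _ = _ := by field_simp; norm_num
    set fp := fourierCoeff N y (m p + e.residual p + 1 / 2) with hfp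
    set fm := fourierCoeff N y (m p + e.residual p + -1 / 2) with hfm
    have hst : stdError N A σ f m δ e.residual R p =
        (R p - δ p - N * meanError N A m δ e.residual p) * g :=
      h.stdError_eq A hσ e.residual R hA htp
    have hlin : linStat (A p) σ t (√N * fp) (√N * fm) =
        Real.pi * gain t / 2 * linError t (fp / A p) (fm / A p) * g := by
      have e1 (z : ℂ) : (√(N : ℝ) : ℂ) * z / A p = ((√(N : ℝ) : ℝ) : ℂ) * (z / A p) := by ring
      rw [linStat_eq, e1, e1, linError_real_mul, gain_eq htp, hg, ← hT]
      field_simp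
    have hrelp : relError N A m δ e y p 1 - fp / A p = leakError N A m δ e p 1 / A p := by
      rw [relError, add_div]; ring
    have hrelm : relError N A m δ e y p (-1) - fm / A p = leakError N A m δ e p (-1) / A p := by
      rw [relError, add_div]; ring
    -- Since `linError` is additive, removing the noise from the linear term leaves the leakage
    -- alone. It is not compared with the mean error: each is small enough by itself.
    have hsub : stdError N A σ f m δ e.residual R p - linStat (A p) σ t (√N * fp) (√N * fm) =
        ((R p - δ p - Real.pi * gain t / 2 * linError t (relError N A m δ e y p 1)
          (relError N A m δ e y p (-1))) +
        Real.pi * gain t / 2 * linError t (leakError N A m δ e p 1 / A p)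
          (leakError N A m δ e p (-1) / A p) -
        N * meanError N A m δ e.residual p) * g := by
      rw [hst, hlin, ← hrelp, ← hrelm, ← linError_sub]
      ring
    have hb1 : |Real.pi * gain t / 2 * linError t (leakError N A m δ e p 1 / A p)
          (leakError N A m δ e p (-1) / A p)| ≤ 1 / (2 * c) * (7 * (M / N / ‖A p‖)) := by
      rw [abs_mul]
      refine mul_le_mul hgain (abs_linError_le htp ?_ ?_) (abs_nonneg _) (by positivity)
      · rw [norm_div]; gcongr; exact hleak 1 (Or.inl rfl)
      · rw [norm_div]; gcongr; exact hleak (-1) (Or.inr rfl)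
    have hb2 : |N * meanError N A m δ e.residual p| ≤ 1 / (2 * c) * (7 * (M' / N)) := by
      rw [h.mul_meanError_eq A hν p, abs_mul]
      exact mul_le_mul hgain (abs_linError_le htp (h.norm_meanLeak_le A hν p (by simp))
        (h.norm_meanLeak_le A hν p (by simp))) (abs_nonneg _) (by positivity)
    have hb3 : |stdError N A σ f m δ e.residual R p - linStat (A p) σ t (√N * fp) (√N * fm)| ≤
        ε / 2 := by
      rw [hsub, abs_mul, abs_of_pos hg0]
      have h1 := (abs_sub _ _).trans (add_le_add ((abs_add_le _ _).trans
        (add_le_add (hmain.trans hrem) hb1)) hb2)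
      have h2 : C * (E * (E + 1)) / N + 1 / (2 * c) * (7 * (M / N / ‖A p‖)) +
          1 / (2 * c) * (7 * (M' / N)) = G / N := by rw [hG]; ring
      rw [h2] at h1
      refine (mul_le_mul h1 hgle hg0.le (by positivity)).trans (le_trans (le_of_eq ?_)
        (hN₄ N (by omega)))
      rw [div_mul_eq_mul_div, div_eq_div_iff hpos.ne' hs0.ne']
      linear_combination G * (4 * ‖A p‖ / σ) * hss
    have hnear (s : ℝ) (hs : s = 1 ∨ s = -1) :
        ‖(√(N : ℝ) : ℂ) * fourierCoeff N y (m p + e.residual p + s / 2) -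
          √(N : ℝ) * fourierCoeff N y (m p + ref p + s / 2)‖ ≤ 2 * Real.pi * η₁ * K := by
      rw [← mul_sub, norm_mul, Complex.norm_real, Real.norm_of_nonneg hs0.le]
      have h1 := norm_fourierCoeff_sub_le h.ne_zero y (m p + ref p + s / 2)
        (m p + e.residual p + s / 2)
      have h2 := (noiseSize_le_totalNoise N m ref y p hs).trans hy
      have h3 := noiseSize_nonneg N y (m p + ref p + s / 2)
      calc _ ≤ √(N : ℝ) * (2 * Real.pi * η₁ * (K / √N)) := by
            gcongr
            refine h1.trans ?_
            gcongr
            exact (hloc s).trans (min_le_left _ _)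
        _ = _ := by field_simp
    have hsize (s : ℝ) (hs : s = 1 ∨ s = -1) :
        ‖(√(N : ℝ) : ℂ) * fourierCoeff N y (m p + ref p + s / 2)‖ ≤ K := by
      rw [norm_mul, Complex.norm_real, Real.norm_of_nonneg hs0.le]
      have h1 := norm_fourierCoeff_le h.ne_zero y (m p + ref p + s / 2)
      have h2 := (noiseSize_le_totalNoise N m ref y p hs).trans hy
      rw [le_div_iff₀' hs0] at h1
      exact h1.trans h2
    have hb4 := hmod t (δ p - ref p) (√N * fp) (√N * fm) _ _ htp ((href p).trans (by norm_num))
      (by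
        rw [ht, sub_sub_sub_cancel_left, abs_sub_comm]
        exact (hres p).trans (min_le_left _ _))
      (hsize 1 (Or.inl rfl)) (hsize (-1) (Or.inr rfl)) (hnear 1 (Or.inl rfl))
      (hnear (-1) (Or.inr rfl))
    have h5 := abs_sub_le (stdError N A σ f m δ e.residual R p)
      (linStat (A p) σ t (√N * fp) (√N * fm)) (noiseStat N A σ m δ ref y p)
    exact h5.trans (by rw [noiseStat]; linarith)

end FreqEst

namespace FreqEst

variable {L : ℕ}

/-! ### Linear statistics of the noise -/

/-- The form is `c.re x - c.im y` with independent real Gaussians of variance `σ²/2`, so only `‖c‖`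
enters. -/
lemma integral_exp_re_circularGaussian (σ : ℝ) (c : ℂ) :
    ∫ z, Complex.exp (((c * z).re : ℂ) * Complex.I) ∂circularGaussian σ =
      Complex.exp (-((σ ^ 2 / 4 * ‖c‖ ^ 2 : ℝ) : ℂ)) := by
  have hm : Measurable fun q : ℝ × ℝ => (q.1 : ℂ) + (q.2 : ℂ) * Complex.I := by fun_prop
  rw [circularGaussian, integral_map hm.aemeasurable
    (Continuous.aestronglyMeasurable (by fun_prop))]
  have e1 (q : ℝ × ℝ) : Complex.exp (((c * ((q.1 : ℂ) + (q.2 : ℂ) * Complex.I)).re : ℂ) *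
      Complex.I) = Complex.exp ((c.re : ℂ) * q.1 * Complex.I) *
        Complex.exp (((-c.im : ℝ) : ℂ) * q.2 * Complex.I) := by
    rw [← Complex.exp_add]
    congr 1
    simp
    ring
  simp only [e1]
  rw [integral_prod_mul (fun x : ℝ => Complex.exp ((c.re : ℂ) * x * Complex.I))
    (fun x : ℝ => Complex.exp (((-c.im : ℝ) : ℂ) * x * Complex.I)),
    ← charFun_apply_real, ← charFun_apply_real, charFun_gaussianReal, charFun_gaussianReal,
    ← Complex.exp_add]
  congr 1
  have : (((σ ^ 2 / 2).toNNReal : ℝ) : ℂ) = σ ^ 2 / 2 := by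
    rw [Real.coe_toNNReal _ (by positivity)]
    push_cast
    rfl
  have hn : ((‖c‖ : ℂ)) ^ 2 = c.re ^ 2 + c.im ^ 2 := by
    rw [← Complex.ofReal_pow, Complex.sq_norm, Complex.normSq_apply]
    push_cast
    ring
  push_cast
  rw [this, hn]
  ring

variable {Ω : Type*} [MeasurableSpace Ω] {P : Measure Ω} {σ : ℝ} {w : ℕ → Ω → ℂ}

lemma integral_exp_re_sum (hw_law : ∀ n, HasLaw (w n) (circularGaussian σ) P)
    (hw_indep : iIndepFun w P) (N : ℕ) (c : ℕ → ℂ) :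
    ∫ ω, Complex.exp (((∑ n ∈ Finset.range N, c n * w n ω).re : ℂ) * Complex.I) ∂P =
      Complex.exp (-((σ ^ 2 / 4 * ∑ n ∈ Finset.range N, ‖c n‖ ^ 2 : ℝ) : ℂ)) := by
  have hi : iIndepFun (fun n : Fin N => w n) P := hw_indep.precomp Fin.val_injective
  have h := hi.integral_fun_prod_comp (fun n => (hw_law n).aemeasurable)
    (f := fun (n : Fin N) z => Complex.exp (((c n * z).re : ℂ) * Complex.I))
    (fun n => Continuous.aestronglyMeasurable (by fun_prop))
  have e1 (n : Fin N) : ∫ ω, Complex.exp (((c n * w n ω).re : ℂ) * Complex.I) ∂P =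
      Complex.exp (-((σ ^ 2 / 4 * ‖c n‖ ^ 2 : ℝ) : ℂ)) := by
    rw [← integral_exp_re_circularGaussian]
    exact (hw_law n).integral_comp (f := fun z => Complex.exp (((c n * z).re : ℂ) * Complex.I))
      (Continuous.aestronglyMeasurable (by fun_prop))
  simp only [e1] at h
  rw [← Complex.exp_sum] at h
  convert h using 1
  · congr 1
    ext ω
    rw [← Complex.exp_sum, ← Finset.sum_mul, ← Complex.ofReal_sum, ← Complex.re_sum,
      Fin.sum_univ_eq_sum_range (fun n => c n * w n ω)]
  · congr 1
    rw [Fin.sum_univ_eq_sum_range (fun n => -((σ ^ 2 / 4 * ‖c n‖ ^ 2 : ℝ) : ℂ)),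
      Finset.sum_neg_distrib, ← Complex.ofReal_sum, Finset.mul_sum]

variable [IsProbabilityMeasure P]

lemma hasLaw_re_sum (hw_law : ∀ n, HasLaw (w n) (circularGaussian σ) P)
    (hw_indep : iIndepFun w P) (N : ℕ) (c : ℕ → ℂ) :
    HasLaw (fun ω => (∑ n ∈ Finset.range N, c n * w n ω).re)
      (gaussianReal 0 (Real.toNNReal (σ ^ 2 / 2 * ∑ n ∈ Finset.range N, ‖c n‖ ^ 2))) P := by
  have hm : AEMeasurable (fun ω => (∑ n ∈ Finset.range N, c n * w n ω).re) P := by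
    have := fun n => (hw_law n).aemeasurable
    fun_prop
  refine ⟨hm, ?_⟩
  have := Measure.isProbabilityMeasure_map hm
  refine Measure.ext_of_charFun (funext fun t => ?_)
  rw [charFun_gaussianReal, charFun_apply_real, integral_map hm
    (Continuous.aestronglyMeasurable (by fun_prop))]
  have h := integral_exp_re_sum hw_law hw_indep N (fun n => t * c n)
  convert h using 1
  · congr 1
    ext ω
    congr 2
    simp only [mul_assoc, ← Finset.mul_sum, Complex.re_ofReal_mul]
    push_cast
    ring
  · rw [Real.coe_toNNReal _ (by positivity)]
    congr 1
    simp only [norm_mul, mul_pow, ← Finset.mul_sum, Complex.norm_real, Real.norm_eq_abs, sq_abs]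
    push_cast
    ring

/-! ### First moments of the noise -/

lemma integrable_norm_sum (hw_law : ∀ n, HasLaw (w n) (circularGaussian σ) P)
    (hw_indep : iIndepFun w P) (N : ℕ) (c : ℕ → ℂ) :
    Integrable (fun ω => ‖∑ n ∈ Finset.range N, c n * w n ω‖) P ∧
      ∫ ω, ‖∑ n ∈ Finset.range N, c n * w n ω‖ ∂P ≤
        1 + σ ^ 2 / 2 * ∑ n ∈ Finset.range N, ‖c n‖ ^ 2 := by
  have key (c : ℕ → ℂ) :
      Integrable (fun ω => (∑ n ∈ Finset.range N, c n * w n ω).re ^ 2) P ∧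
        ∫ ω, (∑ n ∈ Finset.range N, c n * w n ω).re ^ 2 ∂P =
          σ ^ 2 / 2 * ∑ n ∈ Finset.range N, ‖c n‖ ^ 2 := by
    have h := hasLaw_re_sum hw_law hw_indep N c
    set v := Real.toNNReal (σ ^ 2 / 2 * ∑ n ∈ Finset.range N, ‖c n‖ ^ 2) with hv
    have hi : Integrable (fun x : ℝ => x ^ 2) (gaussianReal 0 v) :=
      (memLp_id_gaussianReal' 2 (by simp)).integrable_sq
    constructor
    · rw [← h.map_eq] at hi
      exact hi.comp_aemeasurable h.aemeasurable
    · have h1 := h.integral_comp (f := fun x : ℝ => x ^ 2) hi.aestronglyMeasurable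
      have h2 : ∫ x, x ^ 2 ∂gaussianReal 0 v = v := by
        have h3 := variance_fun_id_gaussianReal (μ := 0) (v := v)
        rwa [variance_of_integral_eq_zero (by fun_prop) (by simp)] at h3
      rw [h2, hv, Real.coe_toNNReal _ (by positivity)] at h1
      exact h1
  have h1 := key c
  -- Rotating the coefficients by `I` gives the imaginary part up to sign, so the law of real parts
  -- also yields the second moment of the norm. The first moment then follows from `r ≤ (r² + 1)/2`.
  have h2 := key (fun n => Complex.I * c n)
  have hmeas : AEStronglyMeasurable (fun ω => ‖∑ n ∈ Finset.range N, c n * w n ω‖) P := by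
    have := fun n => (hw_law n).aemeasurable
    exact AEMeasurable.aestronglyMeasurable (by fun_prop)
  have hadd : Integrable (fun ω => (∑ n ∈ Finset.range N, c n * w n ω).re ^ 2 +
      (∑ n ∈ Finset.range N, Complex.I * c n * w n ω).re ^ 2) P := h1.1.add h2.1
  have hint : Integrable (fun ω => ((∑ n ∈ Finset.range N, c n * w n ω).re ^ 2 +
      (∑ n ∈ Finset.range N, Complex.I * c n * w n ω).re ^ 2 + 1) / 2) P :=
    (hadd.add (integrable_const (1 : ℝ))).div_const 2
  have hle (ω : Ω) : ‖∑ n ∈ Finset.range N, c n * w n ω‖ ≤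
      ((∑ n ∈ Finset.range N, c n * w n ω).re ^ 2 +
        (∑ n ∈ Finset.range N, Complex.I * c n * w n ω).re ^ 2 + 1) / 2 := by
    have e : ∑ n ∈ Finset.range N, Complex.I * c n * w n ω =
        Complex.I * ∑ n ∈ Finset.range N, c n * w n ω := by
      simp only [Finset.mul_sum, mul_assoc]
    rw [e, Complex.I_mul_re, neg_sq]
    have := Complex.sq_norm (∑ n ∈ Finset.range N, c n * w n ω)
    rw [Complex.normSq_apply] at this
    nlinarith [sq_nonneg (‖∑ n ∈ Finset.range N, c n * w n ω‖ - 1)]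
  refine ⟨hint.mono' hmeas (Eventually.of_forall fun ω => ?_), ?_⟩
  · rw [norm_norm]
    exact hle ω
  · refine (integral_mono_of_nonneg (Eventually.of_forall fun ω => norm_nonneg _) hint
      (Eventually.of_forall hle)).trans ?_
    rw [integral_div, integral_add hadd (integrable_const _), integral_add h1.1 h2.1,
      h1.2, h2.2]
    simp
    linarith

/-- Every partial sum has at most `N` unit coefficients and is divided by `√N`. Its first moment is
bounded uniformly, and so is the average over partial sums. -/
lemma integrable_noiseSize (hw_law : ∀ n, HasLaw (w n) (circularGaussian σ) P)
    (hw_indep : iIndepFun w P) (N : ℕ) (k : ℝ) :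
    Integrable (fun ω => noiseSize N (fun n => w n ω) k) P ∧
      ∫ ω, noiseSize N (fun n => w n ω) k ∂P ≤ 2 * (1 + σ ^ 2 / 2) := by
  have key (n : ℕ) (hn : n ≤ N) :
      Integrable (fun ω => ‖∑ j ∈ Finset.range n, w j ω * unitExp (-(k * j / N))‖ / √(N : ℝ)) P ∧
      ∫ ω, ‖∑ j ∈ Finset.range n, w j ω * unitExp (-(k * j / N))‖ / √(N : ℝ) ∂P ≤
        1 + σ ^ 2 / 2 := by
    have h := integrable_norm_sum hw_law hw_indep n
      (fun j => unitExp (-(k * j / N)) / (√(N : ℝ) : ℂ))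
    have e (ω : Ω) : ‖∑ j ∈ Finset.range n, unitExp (-(k * j / N)) / (√(N : ℝ) : ℂ) * w j ω‖ =
        ‖∑ j ∈ Finset.range n, w j ω * unitExp (-(k * j / N))‖ / √(N : ℝ) := by
      have hs : ‖(√(N : ℝ) : ℂ)‖ = √(N : ℝ) := by
        rw [Complex.norm_real, Real.norm_of_nonneg (Real.sqrt_nonneg _)]
      rw [← hs, ← norm_div, Finset.sum_div, hs]
      congr 1
      refine Finset.sum_congr rfl fun j _ => ?_
      ring
    simp only [e] at h
    refine ⟨h.1, h.2.trans ?_⟩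
    have h1 : ∑ j ∈ Finset.range n, ‖unitExp (-(k * j / N)) / (√(N : ℝ) : ℂ)‖ ^ 2 ≤ 1 := by
      simp only [norm_div, norm_unitExp, Complex.norm_real, Real.norm_eq_abs, div_pow, one_pow,
        sq_abs, Real.sq_sqrt (Nat.cast_nonneg N), Finset.sum_const, Finset.card_range, nsmul_eq_mul]
      rw [mul_one_div]
      exact div_le_one_of_le₀ (by exact_mod_cast hn) (by positivity)
    have := mul_le_mul_of_nonneg_left h1 (by positivity : 0 ≤ σ ^ 2 / 2)
    linarith
  have e (ω : Ω) : noiseSize N (fun n => w n ω) k =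
      ‖∑ j ∈ Finset.range N, w j ω * unitExp (-(k * j / N))‖ / √(N : ℝ) +
      (1 / N) * ∑ n ∈ Finset.range N,
        ‖∑ j ∈ Finset.range (n + 1), w j ω * unitExp (-(k * j / N))‖ / √(N : ℝ) := by
    rw [noiseSize, add_div, mul_div_assoc, Finset.sum_div]
  have hi (n : ℕ) (hn : n ∈ Finset.range N) := key (n + 1) (Finset.mem_range.1 hn)
  simp only [e]
  refine ⟨(key N le_rfl).1.add ((integrable_finsetSum _ fun n hn => (hi n hn).1).const_mul _), ?_⟩
  rw [integral_add (key N le_rfl).1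
    ((integrable_finsetSum _ fun n hn => (hi n hn).1).const_mul _), integral_const_mul,
    integral_finsetSum _ fun n hn => (hi n hn).1]
  have h1 := Finset.sum_le_sum fun n hn => (hi n hn).2
  rw [Finset.sum_const, Finset.card_range, nsmul_eq_mul] at h1
  have h2 : (1 / N : ℝ) * (N * (1 + σ ^ 2 / 2)) ≤ 1 + σ ^ 2 / 2 := by
    rw [← mul_assoc]
    refine mul_le_of_le_one_left (by positivity) ?_
    rw [one_div]
    exact inv_mul_le_one
  have h3 := mul_le_mul_of_nonneg_left h1 (by positivity : (0 : ℝ) ≤ 1 / N)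
  linarith [(key N le_rfl).2]

/-- The noise is bounded in probability, uniformly in the sample size and the locations. -/
lemma exists_totalNoise_bound (L : ℕ) (hw_law : ∀ n, HasLaw (w n) (circularGaussian σ) P)
    (hw_indep : iIndepFun w P) {ε : ENNReal} (hε : 0 < ε) : ∃ K : ℝ,
    ∀ (N : ℕ) (m : Fin L → ℤ) (ν : Fin L → ℝ),
      P {ω | K < totalNoise N m ν fun n => w n ω} ≤ ε := by
  set B : ℝ := ∑ _p : Fin L, (2 * (1 + σ ^ 2 / 2) + 2 * (1 + σ ^ 2 / 2)) with hB
  have hB0 : 0 ≤ B := by positivity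
  obtain ⟨r, hr0, hrε⟩ : ∃ r : ℝ, 0 < r ∧ ENNReal.ofReal r ≤ ε := by
    rcases eq_or_ne ε ⊤ with rfl | h
    · exact ⟨1, one_pos, le_top⟩
    · exact ⟨ε.toReal, ENNReal.toReal_pos hε.ne' h, (ENNReal.ofReal_toReal h).le⟩
  -- Markov's inequality; `B + 1` instead of `B` keeps the threshold positive.
  refine ⟨(B + 1) / r, fun N m ν => le_trans ?_ hrε⟩
  have hi := fun (p : Fin L) (s : ℝ) => integrable_noiseSize hw_law hw_indep N (m p + ν p + s / 2)
  have hadd (p : Fin L) : Integrable (fun ω => noiseSize N (fun n => w n ω) (m p + ν p + 1 / 2) +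
      noiseSize N (fun n => w n ω) (m p + ν p + -1 / 2)) P := (hi p 1).1.add (hi p (-1)).1
  have hint : Integrable (fun ω => totalNoise N m ν fun n => w n ω) P :=
    integrable_finsetSum _ fun p _ => hadd p
  have hle : ∫ ω, totalNoise N m ν (fun n => w n ω) ∂P ≤ B := by
    simp only [totalNoise]
    rw [integral_finsetSum _ fun p _ => hadd p]
    refine Finset.sum_le_sum fun p _ => ?_
    rw [integral_add (hi p 1).1 (hi p (-1)).1]
    exact add_le_add (hi p 1).2 (hi p (-1)).2
  have hmk := mul_meas_ge_le_integral_of_nonneg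
    (Eventually.of_forall fun ω => totalNoise_nonneg N m ν fun n => w n ω) hint ((B + 1) / r)
  have hreal : P.real {ω | (B + 1) / r ≤ totalNoise N m ν fun n => w n ω} ≤ r := by
    have h1 := hmk.trans hle
    rw [← le_div_iff₀' (by positivity)] at h1
    refine h1.trans ?_
    rw [div_div_eq_mul_div, div_le_iff₀ (by positivity)]
    nlinarith
  refine (measure_mono (t := {ω | (B + 1) / r ≤ totalNoise N m ν fun n => w n ω})
    fun ω hω => le_of_lt (Set.mem_ofPred_eq ▸ hω)).trans ?_
  rw [← ofReal_measureReal]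
  exact ENNReal.ofReal_le_ofReal hreal

end FreqEst

namespace FreqEst

variable {L : ℕ}

/-! ### Asymptotic normality of the linear statistics -/

/-- Lévy's continuity theorem is applied in the inner product space `EuclideanSpace`, and the result
is carried back to functions by the continuous mapping theorem. -/
lemma tendstoInDistribution_pi_gaussianReal {Ω : Type*} [MeasurableSpace Ω] {P : Measure Ω}
    [IsProbabilityMeasure P] {X : ℕ → Ω → Fin L → ℝ} (hX : ∀ N, AEMeasurable (X N) P)
    (h : ∀ u : Fin L → ℝ, Tendsto
      (fun N => ∫ ω, Complex.exp (((∑ p, u p * X N ω p : ℝ) : ℂ) * Complex.I) ∂P) atTop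
      (𝓝 (Complex.exp (-((∑ p, u p ^ 2) / 2 : ℝ))))) :
    TendstoInDistribution X atTop (id : (Fin L → ℝ) → (Fin L → ℝ)) (fun _ => P)
      (Measure.pi fun _ : Fin L => gaussianReal 0 1) := by
  have hE : TendstoInDistribution (fun N ω => WithLp.toLp 2 (X N ω)) atTop
      (WithLp.toLp 2 : (Fin L → ℝ) → EuclideanSpace ℝ (Fin L)) (fun _ => P)
      (Measure.pi fun _ : Fin L => gaussianReal 0 1) := by
    have hX' (N : ℕ) : AEMeasurable (fun ω => WithLp.toLp 2 (X N ω)) P :=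
      (WithLp.measurable_toLp 2 (Fin L → ℝ)).comp_aemeasurable (hX N)
    refine ⟨hX', (WithLp.measurable_toLp 2 (Fin L → ℝ)).aemeasurable,
      ProbabilityMeasure.tendsto_iff_tendsto_charFun.2 fun u => ?_⟩
    have e1 : charFun ((Measure.pi fun _ : Fin L => gaussianReal 0 1).map (WithLp.toLp 2)) u =
        Complex.exp (-((∑ p, u p ^ 2) / 2 : ℝ)) := by
      rw [charFun_pi, ← Finset.prod_congr rfl fun p _ => (charFun_gaussianReal (u p)).symm,
        ← Complex.exp_sum]
      congr 1
      push_cast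
      simp [Finset.sum_div]
    have e2 (N : ℕ) : charFun (P.map fun ω => WithLp.toLp 2 (X N ω)) u =
        ∫ ω, Complex.exp (((∑ p, u p * X N ω p : ℝ) : ℂ) * Complex.I) ∂P := by
      rw [charFun_apply, integral_map (hX' N) (Continuous.aestronglyMeasurable (by fun_prop))]
      simp [PiLp.inner_apply]
    simp only [ProbabilityMeasure.coe_mk, e1, e2]
    exact h u
  have := hE.continuous_comp (g := fun x : EuclideanSpace ℝ (Fin L) => x.ofLp)
    (PiLp.continuous_ofLp 2 _)
  exact this

/-! ### Asymptotic orthonormality of the exponentials -/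

/-- The quadratic form of almost orthonormal exponentials is close to the sum of squares. -/
lemma norm_quadForm_sub_le {J : Type*} [Fintype J] [DecidableEq J] {η : J → ℂ} {D : J → J → ℂ}
    {M ε : ℝ} (hM : ∀ j, ‖η j‖ ≤ M) (hdiag : ∀ j, D j j = 1) (hoff : ∀ i j, i ≠ j → ‖D i j‖ ≤ ε)
    (hε : 0 ≤ ε) :
    ‖∑ i, ∑ j, η i * (starRingEnd ℂ) (η j) * D i j - ((∑ i, ‖η i‖ ^ 2 : ℝ) : ℂ)‖ ≤
      Fintype.card J * (Fintype.card J * (M * M * ε)) := by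
  have e : ∑ i, ∑ j, η i * (starRingEnd ℂ) (η j) * D i j - ((∑ i, ‖η i‖ ^ 2 : ℝ) : ℂ) =
      ∑ i, ∑ j, if i = j then 0 else η i * (starRingEnd ℂ) (η j) * D i j := by
    push_cast
    rw [← Finset.sum_sub_distrib]
    refine Finset.sum_congr rfl fun i _ => ?_
    rw [← Finset.add_sum_erase _ _ (Finset.mem_univ i), hdiag,
      ← Finset.add_sum_erase _ (fun j => if i = j then 0 else _) (Finset.mem_univ i), if_pos rfl,
      mul_one, Complex.mul_conj', zero_add, add_sub_cancel_left]
    refine Finset.sum_congr rfl fun j hj => ?_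
    rw [if_neg (Finset.ne_of_mem_erase hj).symm]
  rw [e]
  refine (norm_sum_le_of_le (n := fun _ => Fintype.card J * (M * M * ε)) _ fun i _ => ?_).trans_eq
    (by simp)
  refine (norm_sum_le_of_le (n := fun _ => M * M * ε) _ fun j _ => ?_).trans_eq (by simp)
  have hM0 : 0 ≤ M := (norm_nonneg _).trans (hM i)
  split_ifs with h
  · rw [norm_zero]
    positivity
  · rw [norm_mul, norm_mul, RCLike.norm_conj]
    have := hM i
    have := hM j
    have := hoff i j h
    gcongr

/-- The sign `±1` attached to a Boolean. -/
def boolSign (b : Bool) : ℝ := if b then 1 else -1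

lemma boolSign_eq (b : Bool) : boolSign b = 1 ∨ boolSign b = -1 := by cases b <;> simp [boolSign]

/-- The location of one of the Fourier coefficients used for one component. -/
noncomputable def location (m : Fin L → ℤ) (ν : Fin L → ℝ) (j : Fin L × Bool) : ℝ :=
  m j.1 + ν j.1 + boolSign j.2 / 2

/-- Orthogonality over a full period, which needs `N ≥ 2` so that `±1` is not a multiple of `N`. It
makes the two coefficients used for one component exactly uncorrelated. -/
lemma dirichlet_one_eq_zero {N : ℕ} (hN : 2 ≤ N) {s : ℝ} (hs : s = 1 ∨ s = -1) :
    dirichlet N s = 0 := by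
  have hN' : (2 : ℝ) ≤ N := by exact_mod_cast hN
  have hN0 : (0 : ℝ) < N := by linarith
  have h := dirichlet_mul (by omega : N ≠ 0) s
  have h1 : unitExp s = 1 := by
    rcases hs with rfl | rfl
    · exact_mod_cast unitExp_intCast 1
    · exact_mod_cast unitExp_intCast (-1)
  rw [h1, sub_self] at h
  have hπ := Real.pi_pos
  have h2 : unitExp (s / N) - 1 ≠ 0 := by
    rw [← norm_pos_iff, norm_unitExp_sub_one]
    have hpos : 0 < Real.sin (Real.pi * (1 / N)) := by
      apply Real.sin_pos_of_pos_of_lt_pi (by positivity)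
      rw [mul_one_div, div_lt_iff₀ hN0]
      nlinarith
    rcases hs with rfl | rfl
    · positivity
    · rw [neg_div, mul_neg, Real.sin_neg, abs_neg]
      positivity
  have h3 : (N : ℂ) ≠ 0 := by exact_mod_cast hN0.ne'
  simpa [h2, h3] using h

lemma SeparatedAt.norm_dirichlet_location_le {N : ℕ} {f δ : Fin L → ℝ} {m : Fin L → ℤ} {Δ : ℝ}
    (h : SeparatedAt N f δ m Δ) (hN : 2 ≤ N) {ν : Fin L → ℝ} (hν : ∀ l, |δ l - ν l| ≤ 1)
    {i j : Fin L × Bool} (hij : i ≠ j) :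
    ‖dirichlet N (location m ν j - location m ν i)‖ ≤ 1 / (Δ * N) := by
  obtain ⟨p, a⟩ := i
  obtain ⟨q, b⟩ := j
  have hpos := h.cast_pos
  have hΔ := h.pos
  by_cases hpq : q = p
  · subst hpq
    have hab : boolSign b - boolSign a = 2 ∨ boolSign b - boolSign a = -2 := by
      cases a <;> cases b <;> simp [boolSign] at hij ⊢ <;> norm_num
    have : location m ν (q, b) - location m ν (q, a) = (boolSign b - boolSign a) / 2 := by
      simp only [location]; ring
    rw [this, dirichlet_one_eq_zero hN (by rcases hab with h | h <;> rw [h] <;> norm_num), norm_zero]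
    positivity
  · refine norm_dirichlet_le_of_shift h.pos h.large (h.sep q p hpq) ?_
    have h1 := abs_le.1 (hν p)
    have h2 := abs_le.1 (hν q)
    have h4 := h.residual_eq p
    have h5 := h.residual_eq q
    have ha : |boolSign b - boolSign a| ≤ 2 := by
      cases a <;> cases b <;> simp [boolSign] <;> norm_num
    have ha' := abs_le.1 ha
    simp only [location]
    rw [abs_le]
    constructor <;> nlinarith

/-- The coefficient of the noise sample `n` in a linear combination of the linear statistics. -/
noncomputable def noiseCoeff (N : ℕ) (m : Fin L → ℤ) (ν : Fin L → ℝ) (η : Fin L × Bool → ℂ)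
    (n : ℕ) : ℂ :=
  ∑ j, η j * ((1 / √(N : ℝ) : ℝ) * unitExp (-(location m ν j * n / N)))

/-- The Gram matrix of the normalised exponentials consists of Dirichlet kernels at differences of
locations, so the variance of the linear form is a quadratic form in `η`. -/
lemma sum_norm_noiseCoeff_sq {N : ℕ} (hN : N ≠ 0) (m : Fin L → ℤ) (ν : Fin L → ℝ)
    (η : Fin L × Bool → ℂ) :
    ((∑ n ∈ Finset.range N, ‖noiseCoeff N m ν η n‖ ^ 2 : ℝ) : ℂ) =
      ∑ i, ∑ j, η i * (starRingEnd ℂ) (η j) *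
        dirichlet N (location m ν j - location m ν i) := by
  have hN' : (0 : ℝ) < N := by positivity
  have hNC : (N : ℂ) ≠ 0 := by exact_mod_cast hN
  have hs : ((1 / √(N : ℝ) : ℝ) : ℂ) * ((1 / √(N : ℝ) : ℝ) : ℂ) = 1 / N := by
    rw [← Complex.ofReal_mul, div_mul_div_comm, Real.mul_self_sqrt hN'.le]
    push_cast
    ring
  push_cast
  simp only [← Complex.mul_conj', noiseCoeff, map_sum, Finset.sum_mul_sum]
  simp only [dirichlet_eq, Finset.mul_sum]
  rw [Finset.sum_comm]
  refine Finset.sum_congr rfl fun i _ => ?_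
  rw [Finset.sum_comm]
  refine Finset.sum_congr rfl fun j _ => Finset.sum_congr rfl fun n _ => ?_
  have e : unitExp ((location m ν j - location m ν i) / N) ^ n =
      unitExp (-(location m ν i * n / N)) * unitExp (- -(location m ν j * n / N)) := by
    rw [unitExp_pow, ← unitExp_add]
    congr 1
    ring
  rw [e, map_mul, map_mul, Complex.conj_ofReal, conj_unitExp, ← hs]
  ring

lemma sum_mul_noiseStat_eq {N : ℕ} (A : Fin L → ℂ) (σ : ℝ) (m : Fin L → ℤ)
    (δ ν : Fin L → ℝ) (y : ℕ → ℂ) (u : Fin L → ℝ) :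
    ∑ p, u p * noiseStat N A σ m δ ν y p = (∑ n ∈ Finset.range N, noiseCoeff N m ν
      (fun j => u j.1 * weight (A j.1) σ (δ j.1 - ν j.1) (boolSign j.2)) n * y n).re := by
  have hs : (√(N : ℝ) : ℂ) * (1 / N) = ((1 / √(N : ℝ) : ℝ) : ℂ) := by
    have : √(N : ℝ) * (1 / N) = 1 / √N := by
      rw [mul_one_div, Real.sqrt_div_self']
    rw [← this]
    push_cast
    rfl
  simp only [noiseStat, linStat, ← Complex.re_ofReal_mul, ← Complex.re_sum]
  congr 1
  simp only [noiseCoeff, Finset.sum_mul]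
  rw [Finset.sum_comm, Fintype.sum_prod_type]
  refine Finset.sum_congr rfl fun p _ => ?_
  rw [Fintype.sum_bool, fourierCoeff_eq, fourierCoeff_eq, ← mul_assoc (√(N : ℝ) : ℂ),
    ← mul_assoc (√(N : ℝ) : ℂ), hs]
  simp only [Finset.mul_sum, mul_add, location, boolSign, if_true, Bool.false_eq_true, if_false]
  congr 1 <;> exact Finset.sum_congr rfl fun n _ => by ring

variable {Ω : Type*} [MeasurableSpace Ω] {P : Measure Ω} {σ : ℝ} {w : ℕ → Ω → ℂ}

lemma aemeasurable_fourierCoeff (hw : ∀ n, AEMeasurable (w n) P) (N : ℕ) (k : ℝ) :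
    AEMeasurable (fun ω => fourierCoeff N (fun n => w n ω) k) P := by
  unfold fourierCoeff
  fun_prop

lemma aemeasurable_noiseStat (hw : ∀ n, AEMeasurable (w n) P) (N : ℕ) (A : Fin L → ℂ)
    (m : Fin L → ℤ) (δ ν : Fin L → ℝ) :
    AEMeasurable (fun ω => noiseStat N A σ m δ ν fun n => w n ω) P := by
  refine aemeasurable_pi_iff.2 fun p => ?_
  have h := fun k => aemeasurable_fourierCoeff hw N k
  unfold noiseStat linStat
  fun_prop

/-- The linear statistics are asymptotically independent and standard normal. -/
lemma tendstoInDistribution_noiseStat [IsProbabilityMeasure P] (hσ : 0 < σ)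
    (hw_law : ∀ n, HasLaw (w n) (circularGaussian σ) P) (hw_indep : iIndepFun w P)
    {A : Fin L → ℂ} (hA : ∀ l, A l ≠ 0) {f δ ref : ℕ → Fin L → ℝ} {m : ℕ → Fin L → ℤ} {Δ : ℝ}
    (h : ∀ᶠ N in atTop, SeparatedAt N (f N) (δ N) (m N) Δ)
    (href : ∀ N l, |δ N l - ref N l| ≤ 1) :
    TendstoInDistribution
      (fun N ω => noiseStat N A σ (m N) (δ N) (ref N) fun n => w n ω) atTop
      (id : (Fin L → ℝ) → (Fin L → ℝ)) (fun _ => P)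
      (Measure.pi fun _ : Fin L => gaussianReal 0 1) := by
  refine tendstoInDistribution_pi_gaussianReal
    (fun N => aemeasurable_noiseStat (fun n => (hw_law n).aemeasurable) N A _ _ _) fun u => ?_
  set η : ℕ → Fin L × Bool → ℂ := fun N j =>
    u j.1 * weight (A j.1) σ (δ N j.1 - ref N j.1) (boolSign j.2) with hη
  simp only [sum_mul_noiseStat_eq, integral_exp_re_sum hw_law hw_indep]
  refine (Complex.continuous_exp.tendsto _).comp (Tendsto.neg ?_)
  refine (Complex.continuous_ofReal.tendsto _).comp ?_
  -- The diagonal part of the variance does not depend on `N`, although the weights do. No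
  -- convergence of `δ - ref` is needed.
  have hsum (N : ℕ) : ∑ j, ‖η N j‖ ^ 2 = 2 / σ ^ 2 * ∑ p, u p ^ 2 := by
    rw [Fintype.sum_prod_type, Finset.mul_sum]
    refine Finset.sum_congr rfl fun p _ => ?_
    rw [← norm_weight_sq_add (hA p) hσ (δ N p - ref N p), Fintype.sum_bool]
    simp only [hη, boolSign, norm_mul, mul_pow, Complex.norm_real, Real.norm_eq_abs, sq_abs,
      if_true, Bool.false_eq_true, if_false]
    ring
  have hbound (N : ℕ) (j : Fin L × Bool) : ‖η N j‖ ≤ (∑ p, |u p|) * (2 / σ) := by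
    rw [hη, norm_mul, Complex.norm_real, Real.norm_eq_abs]
    refine mul_le_mul ?_ (norm_weight_le (hA _) hσ _ (boolSign_eq _)) (norm_nonneg _)
      (Finset.sum_nonneg fun _ _ => abs_nonneg _)
    exact Finset.single_le_sum (f := fun p => |u p|) (fun _ _ => abs_nonneg _)
      (Finset.mem_univ j.1)
  set c : ℝ := Fintype.card (Fin L × Bool) * (Fintype.card (Fin L × Bool) *
    ((∑ p, |u p|) * (2 / σ) * ((∑ p, |u p|) * (2 / σ)) * (1 / Δ))) with hc
  have hlim : Tendsto (fun N : ℕ => ∑ n ∈ Finset.range N, ‖noiseCoeff N (m N) (ref N) (η N) n‖ ^ 2)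
      atTop (𝓝 (2 / σ ^ 2 * ∑ p, u p ^ 2)) := by
    rw [tendsto_iff_norm_sub_tendsto_zero]
    refine squeeze_zero' (Eventually.of_forall fun N => norm_nonneg _) (g := fun N : ℕ => c / N) ?_
      (tendsto_const_div_atTop_nhds_zero_nat c)
    filter_upwards [h, eventually_ge_atTop 2] with N hN hN2
    have hΔ := hN.pos
    have h1 := norm_quadForm_sub_le (D := fun i j => dirichlet N (location (m N) (ref N) j -
      location (m N) (ref N) i)) (hbound N) (fun j => by
        rw [sub_self, dirichlet_zero hN.ne_zero])
      (fun i j hij => hN.norm_dirichlet_location_le hN2 (href N) hij) (by positivity)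
    rw [← sum_norm_noiseCoeff_sq hN.ne_zero, hsum, ← Complex.ofReal_sub, Complex.norm_real] at h1
    refine h1.trans_eq ?_
    rw [hc]
    field_simp
  convert hlim.const_mul (σ ^ 2 / 4) using 2
  field_simp
  ring

end FreqEst

namespace FreqEst

variable {L : ℕ} {Ω : Type*} [MeasurableSpace Ω] {P : Measure Ω}

/-! ### Events of high probability -/

/-- The events `E N` have probability tending to `1`. -/
def HighProb (P : Measure Ω) (E : ℕ → Ω → Prop) : Prop :=
  Tendsto (fun N => P {ω | ¬E N ω}) atTop (𝓝 0)

lemma HighProb.and {E F : ℕ → Ω → Prop} (hE : HighProb P E) (hF : HighProb P F) :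
    HighProb P fun N ω => E N ω ∧ F N ω := by
  have h := hE.add hF
  rw [add_zero] at h
  refine tendsto_of_tendsto_of_tendsto_of_le_of_le tendsto_const_nhds h (fun _ => zero_le)
    fun N => ?_
  refine (measure_mono fun ω hω => ?_).trans (measure_union_le _ _)
  exact not_and_or.1 hω

lemma HighProb.forall {ι : Type*} [Fintype ι] {E : ι → ℕ → Ω → Prop}
    (h : ∀ i, HighProb P (E i)) : HighProb P fun N ω => ∀ i, E i N ω := by
  have h' := tendsto_finsetSum Finset.univ fun i _ => h i
  simp only [Finset.sum_const_zero] at h'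
  refine tendsto_of_tendsto_of_tendsto_of_le_of_le tendsto_const_nhds h' (fun _ => zero_le)
    fun N => ?_
  refine (measure_mono fun ω hω => ?_).trans (measure_iUnion_fintype_le _ _)
  exact Set.mem_iUnion.2 (not_forall.1 hω)

/-- The events `B K`, which depend on a bound `K`, have probability close to `1` for a suitable
bound. -/
def Tight (P : Measure Ω) (B : ℝ → ℕ → Ω → Prop) : Prop :=
  ∀ ε : ENNReal, 0 < ε → ∃ K : ℝ, 0 ≤ K ∧ ∀ᶠ N in atTop, P {ω | ¬B K N ω} ≤ ε

lemma Tight.and {B B' : ℝ → ℕ → Ω → Prop} (hB : Tight P B) (hB' : Tight P B')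
    (hmono : ∀ K K' N ω, K ≤ K' → B K N ω → B K' N ω)
    (hmono' : ∀ K K' N ω, K ≤ K' → B' K N ω → B' K' N ω) :
    Tight P fun K N ω => B K N ω ∧ B' K N ω := by
  intro ε hε
  obtain ⟨K, hK, h⟩ := hB (ε / 2) (ENNReal.half_pos hε.ne')
  obtain ⟨K', _, h'⟩ := hB' (ε / 2) (ENNReal.half_pos hε.ne')
  refine ⟨max K K', le_max_of_le_left hK, ?_⟩
  filter_upwards [h, h'] with N h1 h2
  rw [← ENNReal.add_halves ε]
  refine ((measure_mono fun ω hω => ?_).trans (measure_union_le _ _)).trans (add_le_add h1 h2)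
  rcases not_and_or.1 hω with hb | hb
  · exact Or.inl fun hb' => hb (hmono _ _ _ _ (le_max_left _ _) hb')
  · exact Or.inr fun hb' => hb (hmono' _ _ _ _ (le_max_right _ _) hb')

lemma Tight.of_highProb {B B' : ℝ → ℕ → Ω → Prop} {G : ℕ → Ω → Prop} (hB : Tight P B)
    (hG : HighProb P G) (h : ∀ K, 0 ≤ K → ∃ K', 0 ≤ K' ∧
      ∀ᶠ N in atTop, ∀ ω, G N ω → B K N ω → B' K' N ω) : Tight P B' := by
  intro ε hε
  obtain ⟨K, hK, hK'⟩ := hB (ε / 2) (ENNReal.half_pos hε.ne')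
  obtain ⟨K', hK0, h'⟩ := h K hK
  refine ⟨K', hK0, ?_⟩
  filter_upwards [hK', h', ENNReal.tendsto_nhds_zero.1 hG (ε / 2) (ENNReal.half_pos hε.ne')]
    with N h1 h2 h3
  rw [← ENNReal.add_halves ε]
  refine ((measure_mono fun ω hω => ?_).trans (measure_union_le _ _)).trans (add_le_add h3 h1)
  by_contra hc
  exact hω (h2 ω (by_contra fun hg => hc (Or.inl hg)) (by_contra fun hb => hc (Or.inr hb)))

/-- The order of choices matters: the probability level fixes the bound `K`, then `K` fixes the
tolerance `η`. Hence closeness must be available for every `η`. -/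
lemma HighProb.of_tight {G : ℝ → ℕ → Ω → Prop} {B : ℝ → ℕ → Ω → Prop} {Q : ℕ → Ω → Prop}
    (hG : ∀ η, 0 < η → HighProb P (G η)) (hB : Tight P B)
    (h : ∀ K, 0 ≤ K → ∃ η, 0 < η ∧ ∀ᶠ N in atTop, ∀ ω, G η N ω → B K N ω → Q N ω) :
    HighProb P Q := by
  refine ENNReal.tendsto_nhds_zero.2 fun ε hε => ?_
  obtain ⟨K, hK, hK'⟩ := hB (ε / 2) (ENNReal.half_pos hε.ne')
  obtain ⟨η, hη, h'⟩ := h K hK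
  filter_upwards [hK', h', ENNReal.tendsto_nhds_zero.1 (hG η hη) (ε / 2) (ENNReal.half_pos hε.ne')]
    with N h1 h2 h3
  rw [← ENNReal.add_halves ε]
  refine ((measure_mono fun ω hω => ?_).trans (measure_union_le _ _)).trans (add_le_add h3 h1)
  by_contra hc
  exact hω (h2 ω (by_contra fun hg => hc (Or.inl hg)) (by_contra fun hb => hc (Or.inr hb)))

/-! ### Measurability of the estimates -/

lemma measurable_gain : Measurable gain := by
  unfold gain
  refine Measurable.ite (measurableSet_eq_fun (by fun_prop) (by fun_prop)) (by fun_prop) ?_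
  fun_prop

lemma measurable_dirichlet (N : ℕ) : Measurable (dirichlet N) := by
  unfold dirichlet
  fun_prop

lemma aemeasurable_interpolate (N : ℕ) {S T : Ω → ℂ} (hS : AEMeasurable S P)
    (hT : AEMeasurable T P) : AEMeasurable (fun ω => interpolate N (S ω) (T ω)) P := by
  have hlog := Complex.measurable_log
  unfold interpolate zInv
  fun_prop

lemma aemeasurable_fourierCoeff_random {x : Ω → ℕ → ℂ} (hx : ∀ n, AEMeasurable (fun ω => x ω n) P)
    (N : ℕ) {k : Ω → ℝ} (hk : AEMeasurable k P) :
    AEMeasurable (fun ω => fourierCoeff N (x ω) (k ω)) P := by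
  unfold fourierCoeff
  fun_prop

/-- Both components of a random estimate are almost everywhere measurable. -/
structure AEMeasurableEstimates (P : Measure Ω) (e : Ω → Estimates L) : Prop where
  residual : ∀ p, AEMeasurable (fun ω => (e ω).residual p) P
  amplitude : ∀ p, AEMeasurable (fun ω => (e ω).amplitude p) P

lemma AEMeasurableEstimates.step {N : ℕ} {mh : Ω → Fin L → ℤ} (hmh : Measurable mh)
    {x : Ω → ℕ → ℂ} (hx : ∀ n, AEMeasurable (fun ω => x ω n) P) {e : Ω → Estimates L}
    (he : AEMeasurableEstimates P e) :
    AEMeasurableEstimates P fun ω => FreqEst.step N (mh ω) (x ω) (e ω) := by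
  have hZ : Measurable fun z : ℤ => (z : ℝ) := measurable_from_top
  have hm (p : Fin L) : AEMeasurable (fun ω => ((mh ω p : ℤ) : ℝ)) P :=
    (hZ.comp ((measurable_pi_apply p).comp hmh)).aemeasurable
  have hmm (l p : Fin L) : AEMeasurable (fun ω => ((mh ω l - mh ω p : ℤ) : ℝ)) P := by
    push_cast
    exact (hm l).sub (hm p)
  have hν := he.residual
  have ha := he.amplitude
  have hD {t : Ω → ℝ} (ht : AEMeasurable t P) : AEMeasurable (fun ω => dirichlet N (t ω)) P :=
    (measurable_dirichlet N).comp_aemeasurable ht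
  have hclean (p : Fin L) (s : ℝ) :
      AEMeasurable (fun ω => cleanCoeff N (mh ω) (x ω) (e ω) p s) P := by
    unfold cleanCoeff leakage
    refine (aemeasurable_fourierCoeff_random hx N (((hm p).add (hν p)).add_const _)).sub ?_
    refine Finset.aemeasurable_fun_sum _ fun l _ => (ha l).mul (hD ?_)
    exact (((hmm l p).add (hν l)).sub (hν p)).sub_const _
  have hres (p : Fin L) : AEMeasurable (fun ω => newResidual N (mh ω) (x ω) (e ω) p) P := by
    unfold newResidual
    exact (hν p).add (aemeasurable_interpolate N (hclean p 1) (hclean p (-1)))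
  refine ⟨hres, fun p => ?_⟩
  change AEMeasurable (fun ω => newAmplitude N (mh ω) (x ω) (newResidual N (mh ω) (x ω) (e ω))
    (e ω).amplitude p) P
  unfold newAmplitude
  refine (aemeasurable_fourierCoeff_random hx N ((hm p).add (hres p))).sub ?_
  refine Finset.aemeasurable_fun_sum _ fun l _ => (ha l).mul (hD ?_)
  exact ((hmm l p).add (hres l)).sub (hres p)

lemma iterate_succ (N : ℕ) (m : Fin L → ℤ) (x : ℕ → ℂ) (e₀ : Estimates L) (i : ℕ) :
    iterate N m x e₀ (i + 1) = step N m x (iterate N m x e₀ i) :=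
  Function.iterate_succ_apply' _ _ _

lemma AEMeasurableEstimates.iterate {N : ℕ} {mh : Ω → Fin L → ℤ} (hmh : Measurable mh)
    {x : Ω → ℕ → ℂ} (hx : ∀ n, AEMeasurable (fun ω => x ω n) P) {e : Ω → Estimates L}
    (he : AEMeasurableEstimates P e) (i : ℕ) :
    AEMeasurableEstimates P fun ω => FreqEst.iterate N (mh ω) (x ω) (e ω) i := by
  induction i with
  | zero => exact he
  | succ i ih =>
    simp only [iterate_succ]
    exact ih.step hmh hx

lemma aemeasurable_stdError {N : ℕ} (A : Fin L → ℂ) (σ : ℝ) (f : Fin L → ℝ) (m : Fin L → ℤ)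
    (δ : Fin L → ℝ) {mh : Ω → Fin L → ℤ} (hmh : Measurable mh) {ν ν' : Ω → Fin L → ℝ}
    (hν : ∀ p, AEMeasurable (fun ω => ν ω p) P) (hν' : ∀ p, AEMeasurable (fun ω => ν' ω p) P) :
    AEMeasurable (fun ω (p : Fin L) => (freq N (mh ω) (ν' ω) p -
      (f p + meanError N A m δ (ν ω) p)) / √(varError N A σ δ (ν ω) p)) P := by
  have hZ : Measurable fun z : ℤ => (z : ℝ) := measurable_from_top
  have hm (p : Fin L) : AEMeasurable (fun ω => ((mh ω p : ℤ) : ℝ)) P :=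
    (hZ.comp ((measurable_pi_apply p).comp hmh)).aemeasurable
  have hg := measurable_gain
  have hD := measurable_dirichlet N
  have hbeta (p l : Fin L) (s : ℝ) : AEMeasurable (fun ω => beta N m δ (ν ω) p l s) P := by
    unfold beta
    fun_prop
  have hleak (p : Fin L) (s : ℝ) : AEMeasurable (fun ω => leakageIm N A m δ (ν ω) p s) P := by
    unfold leakageIm
    fun_prop
  refine aemeasurable_pi_iff.2 fun p => ?_
  unfold freq meanError varError
  fun_prop

/-! ### Iterations -/

/-- The random estimates `e N` are close to the reference residuals and have bounded
amplitudes. -/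
structure Controlled (P : Measure Ω) (e : ℕ → Ω → Estimates L) (ref : ℕ → Fin L → ℝ) : Prop where
  close : ∀ η : ℝ, 0 < η → HighProb P fun N ω => ∀ l, |(e N ω).residual l - ref N l| ≤ η
  tight : Tight P fun K N ω => ∀ l, ‖(e N ω).amplitude l‖ ≤ K

variable {σ Δ : ℝ} {w : ℕ → Ω → ℂ} {A : Fin L → ℂ} {f δ ref : ℕ → Fin L → ℝ} {m : ℕ → Fin L → ℤ}
  {mhat : ℕ → Ω → Fin L → ℤ} {e : ℕ → Ω → Estimates L}

lemma tight_noise [IsProbabilityMeasure P] (hw_law : ∀ n, HasLaw (w n) (circularGaussian σ) P)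
    (hw_indep : iIndepFun w P) (m : ℕ → Fin L → ℤ) (ref : ℕ → Fin L → ℝ) :
    Tight P fun K N ω => totalNoise N (m N) (ref N) (fun n => w n ω) ≤ K := by
  intro ε hε
  obtain ⟨K, hK⟩ := exists_totalNoise_bound L hw_law hw_indep hε
  refine ⟨max K 0, le_max_right _ _, Eventually.of_forall fun N => ?_⟩
  refine (measure_mono fun ω hω => ?_).trans (hK N (m N) (ref N))
  exact (le_max_left K 0).trans_lt (not_le.1 hω)

lemma Controlled.tight_total [IsProbabilityMeasure P] (he : Controlled P e ref)
    (hw_law : ∀ n, HasLaw (w n) (circularGaussian σ) P) (hw_indep : iIndepFun w P)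
    (m : ℕ → Fin L → ℤ) :
    Tight P fun K N ω => (∀ l, ‖(e N ω).amplitude l‖ ≤ K) ∧
      totalNoise N (m N) (ref N) (fun n => w n ω) ≤ K :=
  he.tight.and (tight_noise hw_law hw_indep m ref) (fun _ _ _ _ hK h l => (h l).trans hK)
    fun _ _ _ _ hK h => h.trans hK

lemma Controlled.highProb_approx [IsProbabilityMeasure P] (he : Controlled P e ref) (hσ : 0 < σ)
    (hw_law : ∀ n, HasLaw (w n) (circularGaussian σ) P) (hw_indep : iIndepFun w P)
    (hA : ∀ l, A l ≠ 0) (hΔ : 0 < Δ) (h : ∀ᶠ N in atTop, SeparatedAt N (f N) (δ N) (m N) Δ)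
    (href : ∀ N l, |δ N l - ref N l| ≤ 1) (hmhat : HighProb P fun N ω => mhat N ω = m N)
    {ε : ℝ} (hε : 0 < ε) :
    HighProb P fun N ω => ∀ p,
      |newResidual N (mhat N ω) (fun n => tones A (f N) n + w n ω) (e N ω) p - δ N p| ≤ ε ∧
      |stdError N A σ (f N) (m N) (δ N) (e N ω).residual
          (newResidual N (mhat N ω) (fun n => tones A (f N) n + w n ω) (e N ω)) p -
        noiseStat N A σ (m N) (δ N) (ref N) (fun n => w n ω) p| ≤ ε := by
  refine HighProb.forall fun p => HighProb.of_tight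
    (fun η hη => hmhat.and (he.close η hη)) (he.tight_total hw_law hw_indep m) fun K hK => ?_
  obtain ⟨η, hη, N₀, hN₀⟩ := exists_stdError_approx A (hA p) hσ hΔ hK hε
  refine ⟨η, hη, ?_⟩
  filter_upwards [h, eventually_ge_atTop N₀] with N hN hNN ω hG hB
  rw [hG.1]
  exact hN₀ N hNN hN (href N) hG.2 hB.1 hB.2

/-- Whatever the old reference, one step is consistent and the new reference is the true residual.
Only boundedness of the amplitudes, not their consistency, has to be propagated. -/
lemma Controlled.step [IsProbabilityMeasure P] (he : Controlled P e ref) (hσ : 0 < σ)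
    (hw_law : ∀ n, HasLaw (w n) (circularGaussian σ) P) (hw_indep : iIndepFun w P)
    (hA : ∀ l, A l ≠ 0) (hΔ : 0 < Δ) (h : ∀ᶠ N in atTop, SeparatedAt N (f N) (δ N) (m N) Δ)
    (href : ∀ N l, |δ N l - ref N l| ≤ 1) (hmhat : HighProb P fun N ω => mhat N ω = m N) :
    Controlled P
      (fun N ω => FreqEst.step N (mhat N ω) (fun n => tones A (f N) n + w n ω) (e N ω)) δ := by
  have happ := fun ε (hε : (0 : ℝ) < ε) =>
    he.highProb_approx hσ hw_law hw_indep hA hΔ h href hmhat hε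
  have hclose : ∀ η : ℝ, 0 < η → HighProb P fun N ω => ∀ l,
      |newResidual N (mhat N ω) (fun n => tones A (f N) n + w n ω) (e N ω) l - δ N l| ≤ η := by
    intro η hη
    refine tendsto_of_tendsto_of_tendsto_of_le_of_le tendsto_const_nhds (happ η hη)
      (fun _ => zero_le) fun N => measure_mono fun ω hω hc => hω fun l => (hc l).1
  refine ⟨hclose, Tight.of_highProb (he.tight_total hw_law hw_indep m)
    (hmhat.and (hclose 1 one_pos)) fun K hK => ?_⟩
  have hπ := Real.pi_pos
  refine ⟨∑ l, ‖A l‖ + (1 + 2 * Real.pi * 3) * K + L * K, by positivity, ?_⟩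
  filter_upwards [h] with N hN ω hG hB l
  refine norm_newAmplitude_le hN.ne_zero A hB.1 (ref := ref N) ?_ ?_
  · rw [hG.1]
    exact hB.2
  · have h1 := abs_le.1 (hG.2 l)
    have h2 := abs_le.1 (href N l)
    rw [abs_le]
    constructor <;> linarith

/-- Slutsky's theorem: the standardised errors differ from the noise statistics at the reference
residuals by a term tending to 0 in measure. On the event of correct bins, estimated bins may be
replaced by true ones. -/
lemma Controlled.tendstoInDistribution [IsProbabilityMeasure P] (he : Controlled P e ref)
    (hσ : 0 < σ) (hw_law : ∀ n, HasLaw (w n) (circularGaussian σ) P) (hw_indep : iIndepFun w P)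
    (hA : ∀ l, A l ≠ 0) (hΔ : 0 < Δ) (h : ∀ᶠ N in atTop, SeparatedAt N (f N) (δ N) (m N) Δ)
    (href : ∀ N l, |δ N l - ref N l| ≤ 1) (hmhat_meas : ∀ N, Measurable (mhat N))
    (hmhat : HighProb P fun N ω => mhat N ω = m N)
    (he_meas : ∀ N, AEMeasurableEstimates P (e N)) :
    TendstoInDistribution
      (fun (N : ℕ) (ω : Ω) (p : Fin L) =>
        (freq N (mhat N ω)
            (newResidual N (mhat N ω) (fun n => tones A (f N) n + w n ω) (e N ω)) p -
          (f N p + meanError N A (m N) (δ N) (e N ω).residual p)) /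
            √(varError N A σ (δ N) (e N ω).residual p))
      atTop (id : (Fin L → ℝ) → (Fin L → ℝ)) (fun _ => P)
      (Measure.pi fun _ : Fin L => gaussianReal 0 1) := by
  refine tendstoInDistribution_of_tendstoInMeasure_sub _ _
    (tendstoInDistribution_noiseStat hσ hw_law hw_indep hA h href) ?_ fun N => ?_
  · rw [tendstoInMeasure_iff_norm]
    intro ε hε
    refine tendsto_of_tendsto_of_tendsto_of_le_of_le tendsto_const_nhds
      (hmhat.and (he.highProb_approx hσ hw_law hw_indep hA hΔ h href hmhat (half_pos hε)))
      (fun _ => zero_le) fun N => measure_mono fun ω hω hc => ?_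
    have hle : ‖(fun p => stdError N A σ (f N) (m N) (δ N) (e N ω).residual
        (newResidual N (mhat N ω) (fun n => tones A (f N) n + w n ω) (e N ω)) p -
        noiseStat N A σ (m N) (δ N) (ref N) (fun n => w n ω) p)‖ ≤ ε / 2 :=
      (pi_norm_le_iff_of_nonneg (half_pos hε).le).2 fun p => (hc.2 p).2
    have hω' : ε ≤ ‖(fun p => stdError N A σ (f N) (m N) (δ N) (e N ω).residual
        (newResidual N (mhat N ω) (fun n => tones A (f N) n + w n ω) (e N ω)) p -
        noiseStat N A σ (m N) (δ N) (ref N) (fun n => w n ω) p)‖ := by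
      have h1 : ε ≤ _ := hω
      refine h1.trans_eq (congrArg norm (funext fun p => ?_))
      simp only [stdError, Pi.sub_apply, Pi.zero_apply, sub_zero, hc.1]
    linarith
  · have hx (n : ℕ) : AEMeasurable (fun ω => tones A (f N) n + w n ω) P :=
      ((hw_law n).aemeasurable).const_add _
    exact aemeasurable_stdError A σ (f N) (m N) (δ N) (hmhat_meas N) (he_meas N).residual
      ((he_meas N).step (N := N) (hmhat_meas N) hx).residual

end FreqEst

/-! ### Asymptotic normality and the leakage bias -/

theorem theorem1
    {Ω : Type*} [MeasurableSpace Ω] (P : Measure Ω) [IsProbabilityMeasure P]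
    {L : ℕ}
    -- amplitudes, and frequencies that may depend on the sample size `N`
    (A : Fin L → ℂ) (hA : ∀ l, A l ≠ 0)
    (f : ℕ → Fin L → ℝ) (hf : ∀ N l, f N l ∈ Set.Icc (-(1 / 2) : ℝ) (1 / 2))
    (hsep : FreqEst.SeparatedFrequencies f)
    -- white circular complex Gaussian noise
    (σ : ℝ) (hσ : 0 < σ) (w : ℕ → Ω → ℂ)
    (hw_law : ∀ n, HasLaw (w n) (FreqEst.circularGaussian σ) P) (hw_indep : iIndepFun w P)
    -- true maximum bins, and coarse estimates of them
    (m : ℕ → Fin L → ℤ) (hm : ∀ (N : ℕ) l, |(N : ℝ) * f N l - m N l| ≤ 1 / 2)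
    (mhat : ℕ → Ω → Fin L → ℤ) (hmhat_meas : ∀ N, Measurable (mhat N))
    (hmhat : Tendsto (fun N => P {ω | mhat N ω = m N}) atTop (𝓝 1))
    -- starting values of the residuals, and of the amplitudes (bounded in probability)
    (ν₀ : ℕ → Fin L → ℝ) (hν₀ : ∀ N l, ν₀ N l ∈ Set.Icc (-(1 / 2) : ℝ) (1 / 2))
    (a₀ : ℕ → Ω → Fin L → ℂ) (ha₀_meas : ∀ N, Measurable (a₀ N))
    (ha₀ : ∀ ε : ENNReal, 0 < ε → ∃ C : ℝ, ∀ N, P {ω | C < ‖a₀ N ω‖} ≤ ε) :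
    let δ : ℕ → Fin L → ℝ := fun N l => (N : ℝ) * f N l - m N l
    let x : ℕ → Ω → ℕ → ℂ := fun N ω n => FreqEst.tones A (f N) n + w n ω
    let est : ℕ → ℕ → Ω → FreqEst.Estimates L := fun i N ω =>
      FreqEst.iterate N (mhat N ω) (x N ω) ⟨ν₀ N, a₀ N ω⟩ i
    -- asymptotic independence and normality of the frequency estimates of every iteration
    (∀ i : ℕ,
      TendstoInDistribution
        (fun (N : ℕ) (ω : Ω) (p : Fin L) =>
          (FreqEst.freq N (mhat N ω) (est (i + 1) N ω).residual p -
              (f N p + FreqEst.meanError N A (m N) (δ N) (est i N ω).residual p)) /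
            Real.sqrt (FreqEst.varError N A σ (δ N) (est i N ω).residual p))
        atTop (id : (Fin L → ℝ) → (Fin L → ℝ)) (fun _ => P)
        (Measure.pi fun _ : Fin L => gaussianReal 0 1)) ∧
    -- the mean is the error caused by the leakage alone, to leading order
    (∀ b : ℕ → Fin L → ℂ, (∃ C : ℝ, ∀ N l, ‖b N l‖ ≤ C) → ∀ p : Fin L,
      (fun N : ℕ =>
        FreqEst.freq N (m N)
            (FreqEst.newResidual N (m N) (FreqEst.tones A (f N))
              ⟨ν₀ N, FreqEst.newAmplitude N (m N) (FreqEst.tones A (f N)) (ν₀ N) (b N)⟩) p -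
          (f N p + FreqEst.meanError N A (m N) (δ N) (ν₀ N) p))
        =O[atTop] fun N : ℕ => (1 : ℝ) / (N : ℝ) ^ 3) := by
  intro δ x est
  obtain ⟨Δ, hΔ, hsep⟩ := hsep
  have hS : ∀ᶠ N : ℕ in atTop, FreqEst.SeparatedAt N (f N) (δ N) (m N) Δ := by
    filter_upwards [eventually_ge_atTop ⌈8 / Δ⌉₊] with N hN
    exact ⟨hΔ, Nat.ceil_le.1 hN, hsep N, fun _ => rfl, hm N⟩
  have href₀ : ∀ N l, |δ N l - ν₀ N l| ≤ 1 := by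
    intro N l
    have h1 := abs_le.1 (hm N l)
    have h2 := hν₀ N l
    exact abs_le.2 ⟨by linarith [h1.1, h2.2], by linarith [h1.2, h2.1]⟩
  refine ⟨fun i => ?_, fun b ⟨C, hC⟩ p => ?_⟩
  · have hmh : FreqEst.HighProb P fun N ω => mhat N ω = m N := by
      have h : Tendsto (fun N => 1 - P {ω | mhat N ω = m N}) atTop (𝓝 (1 - 1)) :=
        ENNReal.Tendsto.sub tendsto_const_nhds hmhat (Or.inl ENNReal.one_ne_top)
      rw [tsub_self] at h
      refine h.congr fun N => ?_
      exact (prob_compl_eq_one_sub (μ := P)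
        ((hmhat_meas N) (measurableSet_singleton (m N)))).symm
    have h₀ : FreqEst.Controlled P (est 0) ν₀ := by
      refine ⟨fun η hη => ?_, fun ε hε => ?_⟩
      · refine tendsto_const_nhds.congr fun N => ?_
        have : {ω | ¬∀ l, |(est 0 N ω).residual l - ν₀ N l| ≤ η} = ∅ := by
          refine Set.eq_empty_of_forall_notMem fun ω hω => hω fun l => ?_
          have : (est 0 N ω).residual l = ν₀ N l := rfl
          rw [this, sub_self, abs_zero]
          exact hη.le
        rw [this, measure_empty]
      · obtain ⟨K, hK⟩ := ha₀ ε hε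
        refine ⟨max K 0, le_max_right _ _, Eventually.of_forall fun N => ?_⟩
        refine (measure_mono fun ω hω => ?_).trans (hK N)
        obtain ⟨l, hl⟩ := not_forall.1 hω
        exact (le_max_left K 0).trans_lt ((not_le.1 hl).trans_le (norm_le_pi_norm (a₀ N ω) l))
    -- The reference is `ν₀` for the starting values and `δ` after any step. Both lie within
    -- distance 1 of `δ`.
    have hcontrol : ∀ i, ∃ ref : ℕ → Fin L → ℝ, (∀ N l, |δ N l - ref N l| ≤ 1) ∧
        FreqEst.Controlled P (est i) ref := by
      intro i
      induction i with
      | zero => exact ⟨ν₀, href₀, h₀⟩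
      | succ i ih =>
        obtain ⟨ref, href, hi⟩ := ih
        refine ⟨δ, fun N l => by simp, ?_⟩
        have hstep := hi.step hσ hw_law hw_indep hA hΔ hS href hmh
        convert hstep using 3 with N ω
        exact FreqEst.iterate_succ _ _ _ _ _
    obtain ⟨ref, href, hi⟩ := hcontrol i
    have hmeas : ∀ N, FreqEst.AEMeasurableEstimates P (est i N) := fun N =>
      FreqEst.AEMeasurableEstimates.iterate (x := x N) (e := fun ω => ⟨ν₀ N, a₀ N ω⟩)
        (hmhat_meas N) (fun n => ((hw_law n).aemeasurable).const_add _)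
        ⟨fun p => aemeasurable_const, fun p =>
          ((measurable_pi_apply p).comp (ha₀_meas N)).aemeasurable⟩ i
    have h := hi.tendstoInDistribution hσ hw_law hw_indep hA hΔ hS href hmhat_meas hmh hmeas
    convert h using 5 with N ω p
    simp only [est, FreqEst.iterate_succ]
    rfl
  -- The bound `C` may be negative when there are no components or none is constrained by sign, so
  -- it is replaced by its positive part.
  · have hC0 : (0 : ℝ) ≤ max C 0 := le_max_right _ _
    obtain ⟨K, N₀, h⟩ := FreqEst.exists_leakage_expansion A (hA p) hΔ hC0
    refine IsBigO.of_bound K ?_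
    filter_upwards [hS, eventually_ge_atTop N₀] with N hN hNN
    rw [Real.norm_eq_abs, Real.norm_of_nonneg (by positivity)]
    exact h N hNN hN (fun l => (href₀ N l).trans (by norm_num))
      fun l => (hC N l).trans (le_max_left _ _)
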